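/- Let $K$ be a field, let $L\supseteq K$ be an infinite extension field (for example $L=K$ if $K$ is infinite, or $L=\overline K$ for an arbitrary field $K$), and let $n\ge 0$. For a field $F$ let $\mathrm{Aut}_0(F[x_1,\dots,x_n])$ be the group, under composition, of the $F$-algebra automorphisms $f$ of $F[x_1,\dots,x_n]$ that map the augmentation ideal $(x_1,\dots,x_n)$ into itself, and for $N\ge 1$ let the augmentation subgroup $H_N(F)\subseteq \mathrm{Aut}_0(F[x_1,\dots,x_n])$ consist of those $f$ with $f(x_i)\equiv x_i \bmod (x_1,\dots,x_n)^N$ for all $i$. Regard $G=\mathrm{Aut}_0(L[x_1,\dots,x_n])$ as an Ind-variety over $K$, filtered by the sets $M_d=\{f\in G:\deg f(x_i)\le d \text{ for all } i\}$, $d\ge 0$, each placed in an affine space by the coefficients of $f(x_1),\dots,f(x_n)$. A function $M_d\to L$ is called regular over $K$ if for every point $a\in M_d$ there are polynomials $P,Q$ over $K$ in these coefficients such that $Q(a)\ne 0$ and the function equals $P/Q$ at all points of $M_d$ where $Q\neq 0$. A map $\varphi:G\to G$ is a morphism of Ind-varieties over $K$ if for every $d$ there is a $d'$ with $\varphi(M_d)\subseteq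 M_{d'}$ and the coefficients of $\varphi(f)(x_1),\dots,\varphi(f)(x_n)$ are functions of $f\in M_d$ that are regular over $K$. An Ind-scheme automorphism of $G$ over $K$ is a group automorphism $\varphi$ of $G$ such that $\varphi$ and $\varphi^{-1}$ are morphisms of Ind-varieties over $K$. Theorem. Let $\varphi$ be an Ind-scheme automorphism of $G$ over $K$ and let $N>1$. Then $\varphi(H_N(L))\subseteq H_N(L)$. Moreover, if $\mathrm{Aut}_0(K[x_1,\dots,x_n])$ is viewed as a subgroup of $G$ by extension of scalars, then $\varphi(H_N(K))\subseteq H_N(K)$. -/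

import Mathlib

open MvPolynomial

noncomputable section

namespace PolyAut

/-- The augmentation ideal `(x_1, …, x_n)` of the polynomial ring. -/
abbrev augIdeal (K : Type*) [Field K] (n : ℕ) : Ideal (MvPolynomial (Fin n) K) :=
  idealOfVars (Fin n) K

/-- An automorphism that maps the augmentation ideal into itself does not change constant terms. -/
theorem constantCoeff_apply {K : Type*} [Field K] {n : ℕ}
    (f : MvPolynomial (Fin n) K ≃ₐ[K] MvPolynomial (Fin n) K)
    (hf : ∀ p ∈ augIdeal K n, f p ∈ augIdeal K n) (p : MvPolynomial (Fin n) K) :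
    constantCoeff (f p) = constantCoeff p := by
  have key : (aeval (fun _ : Fin n => (0 : K))).comp f.toAlgHom
      = aeval (fun _ : Fin n => (0 : K)) := by
    apply MvPolynomial.algHom_ext
    intro i
    have h1 : f (X i) ∈ augIdeal K n := hf _ (Ideal.subset_span ⟨i, rfl⟩)
    have h2 : augIdeal K n ≤ RingHom.ker (aeval (fun _ : Fin n => (0 : K))).toRingHom := by
      refine Ideal.span_le.2 ?_
      rintro _ ⟨j, rfl⟩
      simp [RingHom.mem_ker]
    have h3 : (aeval (fun _ : Fin n => (0 : K))) (f (X i)) = 0 := h2 h1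
    simpa using h3
  have h := DFunLike.congr_fun key p
  have e : ∀ q : MvPolynomial (Fin n) K,
      aeval (fun _ : Fin n => (0 : K)) q = constantCoeff q := by
    intro q
    simp
  simpa [e] using h

theorem mem_augIdeal_iff {K : Type*} [Field K] {n : ℕ} (p : MvPolynomial (Fin n) K) :
    p ∈ augIdeal K n ↔ constantCoeff p = 0 := by
  rw [augIdeal, idealOfVars, ← Set.image_univ, mem_ideal_span_X_image]
  constructor
  · intro h
    by_contra hne
    obtain ⟨i, -, hi⟩ := h 0 (by simpa [mem_support_iff, constantCoeff_eq] using hne)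
    exact hi rfl
  · intro h m hm
    by_contra hall
    have hm0 : m = 0 := by
      ext i
      by_contra hi
      exact hall ⟨i, Set.mem_univ i, hi⟩
    rw [mem_support_iff, hm0] at hm
    exact hm h

/-- `Aut₀(K[x_1, …, x_n])`: the group (under composition) of the `K`-algebra automorphisms of
`K[x_1, …, x_n]` that map the augmentation ideal into itself, that is, preserve the origin. -/
def Aut0 (K : Type*) [Field K] (n : ℕ) :
    Subgroup (MvPolynomial (Fin n) K ≃ₐ[K] MvPolynomial (Fin n) K) where
  carrier := {f | ∀ p ∈ augIdeal K n, f p ∈ augIdeal K n}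
  one_mem' := fun _ hp => hp
  mul_mem' := fun {_ _} hf hg p hp => hf _ (hg p hp)
  inv_mem' := by
    intro f hf p hp
    rw [mem_augIdeal_iff] at hp ⊢
    rw [← constantCoeff_apply f hf (f⁻¹ p)]
    rw [← AlgEquiv.mul_apply, mul_inv_cancel]
    simpa using hp

theorem map_pow_mem {K : Type*} [Field K] {n : ℕ} (f : Aut0 K n) (N : ℕ)
    {p : MvPolynomial (Fin n) K} (hp : p ∈ augIdeal K n ^ N) :
    f.1 p ∈ augIdeal K n ^ N := by
  have h1 : (augIdeal K n).map (f.1 : MvPolynomial (Fin n) K →+* MvPolynomial (Fin n) K)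
      ≤ augIdeal K n := Ideal.map_le_iff_le_comap.2 fun q hq => f.2 q hq
  have h2 := Ideal.mem_map_of_mem
    (f.1 : MvPolynomial (Fin n) K →+* MvPolynomial (Fin n) K) hp
  rw [Ideal.map_pow] at h2
  exact Ideal.pow_right_mono h1 N h2

/-- The augmentation subgroup `H_N` of `Aut₀(K[x_1, …, x_n])`: the automorphisms `f` with
`f(x_i) ≡ x_i` modulo `(x_1, …, x_n)^N` for all `i`. -/
def augSubgroup (K : Type*) [Field K] (n N : ℕ) : Subgroup (Aut0 K n) where
  carrier := {f | ∀ i, f.1 (X i) - X i ∈ augIdeal K n ^ N}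
  one_mem' := by intro i; simp
  mul_mem' := by
    intro f g hf hg i
    have h : (f * g).1 (X i) - X i = f.1 (g.1 (X i) - X i) + (f.1 (X i) - X i) := by
      simp
    rw [h]
    exact Ideal.add_mem _ (map_pow_mem f N (hg i)) (hf i)
  inv_mem' := by
    intro f hf i
    have h : (f⁻¹).1 (X i) - X i = -((f⁻¹).1 (f.1 (X i) - X i)) := by
      have h2 : (f⁻¹).1 (f.1 (X i)) = X i := by
        rw [← AlgEquiv.mul_apply]
        simp
      rw [map_sub, h2]
      ring
    rw [h]
    exact neg_mem (map_pow_mem f⁻¹ N (hf i))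

/-- The `d`-th piece of the ind-variety `Aut₀`: the automorphisms of degree at most `d`. -/
def degreeLE (L : Type*) [Field L] (n d : ℕ) : Set (Aut0 L n) :=
  {f | ∀ i, (f.1 (X i)).totalDegree ≤ d}

/-- The affine coordinates of an automorphism: its value at `(i, m)` is the coefficient of the
monomial `x^m` in `f(x_i)`. On the automorphisms of degree at most `d` all but a fixed finite set
of these vanish, so that `degreeLE L n d` is a subset of a finite-dimensional affine space. -/
def coord {L : Type*} [Field L] {n : ℕ} (f : Aut0 L n) : Fin n × (Fin n →₀ ℕ) → L :=
  fun q => coeff q.2 (f.1 (X q.1))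

/-- `F` is a regular function, defined over `K`, on the set `S` of `L`-points: near every point
of `S` (in the Zariski topology) it is a quotient of two polynomials, with coefficients in `K`,
in the coordinates. -/
def IsRegularOn (K : Type*) {L : Type*} [Field K] [Field L] [Algebra K L] {n : ℕ}
    (S : Set (Aut0 L n)) (F : Aut0 L n → L) : Prop :=
  ∀ a ∈ S, ∃ P Q : MvPolynomial (Fin n × (Fin n →₀ ℕ)) K,
    aeval (coord a) Q ≠ 0 ∧
    ∀ b ∈ S, aeval (coord b) Q ≠ 0 → F b = aeval (coord b) P / aeval (coord b) Q

/-- A map `Aut₀ → Aut₀` is a morphism of ind-varieties over `K` if it sends every piece of the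
degree filtration into some piece, by a map whose coordinates are regular functions. -/
def IsIndMorphism (K : Type*) {L : Type*} [Field K] [Field L] [Algebra K L] {n : ℕ}
    (φ : Aut0 L n → Aut0 L n) : Prop :=
  ∀ d : ℕ, ∃ d' : ℕ, Set.MapsTo φ (degreeLE L n d) (degreeLE L n d') ∧
    ∀ q : Fin n × (Fin n →₀ ℕ), IsRegularOn K (degreeLE L n d) (fun f => coord (φ f) q)

/-- A group automorphism of `Aut₀` is an ind-scheme automorphism over `K` if both it and its
inverse are morphisms of ind-varieties over `K`. -/
def IsIndAut (K : Type*) {L : Type*} [Field K] [Field L] [Algebra K L] {n : ℕ}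
    (φ : Aut0 L n ≃* Aut0 L n) : Prop :=
  IsIndMorphism K φ ∧ IsIndMorphism K φ.symm

/-- Extension of scalars of an algebra endomorphism of the polynomial ring. -/
def extendHom {K : Type*} (L : Type*) [Field K] [Field L] [Algebra K L] {n : ℕ}
    (f : MvPolynomial (Fin n) K →ₐ[K] MvPolynomial (Fin n) K) :
    MvPolynomial (Fin n) L →ₐ[L] MvPolynomial (Fin n) L :=
  aeval fun i => map (algebraMap K L) (f (X i))

theorem extendHom_map {K L : Type*} [Field K] [Field L] [Algebra K L] {n : ℕ}
    (f : MvPolynomial (Fin n) K →ₐ[K] MvPolynomial (Fin n) K) (p : MvPolynomial (Fin n) K) :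
    extendHom L f (map (algebraMap K L) p) = map (algebraMap K L) (f p) := by
  induction p using MvPolynomial.induction_on with
  | C a =>
    have h : f (C a) = C a := f.commutes a
    rw [h, map_C]
    exact (extendHom L f).commutes _
  | add p q hp hq => simp only [map_add, hp, hq]
  | mul_X p i hp =>
    simp only [map_mul, hp, map_X]
    simp [extendHom]

theorem extendHom_comp {K L : Type*} [Field K] [Field L] [Algebra K L] {n : ℕ}
    (f g : MvPolynomial (Fin n) K →ₐ[K] MvPolynomial (Fin n) K) :
    (extendHom L f).comp (extendHom L g) = extendHom L (f.comp g) := by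
  apply MvPolynomial.algHom_ext
  intro i
  have h : extendHom L g (X i) = map (algebraMap K L) (g (X i)) := by simp [extendHom]
  rw [AlgHom.comp_apply, h, extendHom_map]
  simp [extendHom]

theorem extendHom_id (K L : Type*) [Field K] [Field L] [Algebra K L] (n : ℕ) :
    extendHom L (AlgHom.id K (MvPolynomial (Fin n) K)) = AlgHom.id L _ := by
  apply MvPolynomial.algHom_ext
  intro i
  simp [extendHom]

/-- Extension of scalars `Aut₀(K[x_1, …, x_n]) → Aut₀(L[x_1, …, x_n])`: the polynomials `f(x_i)`
are read as polynomials over `L`. -/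
def extendScalars {K : Type*} (L : Type*) [Field K] [Field L] [Algebra K L] {n : ℕ}
    (f : Aut0 K n) : Aut0 L n :=
  ⟨AlgEquiv.ofAlgHom (extendHom L f.1.toAlgHom) (extendHom L f.1.symm.toAlgHom)
    (by
      rw [extendHom_comp, ← extendHom_id K L n]
      congr 1
      ext i
      simp)
    (by
      rw [extendHom_comp, ← extendHom_id K L n]
      congr 1
      ext i
      simp), by
    have h : augIdeal L n ≤ (augIdeal L n).comap (extendHom L f.1.toAlgHom) := by
      refine Ideal.span_le.2 ?_
      rintro _ ⟨i, rfl⟩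
      have h1 : constantCoeff (f.1 (X i)) = 0 := by
        rw [constantCoeff_apply f.1 f.2]
        simp
      have h2 : extendHom L f.1.toAlgHom (X i) ∈ augIdeal L n := by
        rw [mem_augIdeal_iff]
        simp [extendHom, constantCoeff_map, h1]
      exact h2
    exact fun p hp => h hp⟩

end PolyAut

end

/-!
The dilations `X i ↦ t • X i` detect the augmentation subgroups: conjugation by the dilation with
factor `t` multiplies the part of degree `k` of an automorphism by `t ^ (k - 1)`. So `f` lies in
`H_N` if and only if its conjugates by dilations converge to the identity to order `t ^ (N - 1)`
for `t → 0`. This contraction is expressed by polynomials in `t`, and an ind-automorphism `φ`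
turns it into a statement on conjugates by the images `E t` of the dilations
(`IsRegularOn.along_curve`). What has to be shown is that `E t` acts on `𝔪 / 𝔪 ^ (k + 1)`, where
`𝔪` is the augmentation ideal, with the same weights `t, t ^ 2, …, t ^ k` as the dilations, or
with their inverses.

A representation of `Lˣ` by matrices of rational functions is the sum of its weight parts: the
coefficients of its Laurent expansion at `0` are eigenvectors (`exists_weight_decomposition`).
This is applied to the action of `E t` on jets.

* The linear part of `E t` is a scalar `t ^ a` (`exists_linearPart_map_dilation`). Every
  automorphism is contracted to its linear part by the dilations, so every automorphism `g = φ f`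
  has conjugates by `E t` with a limit for `t → 0`. If `g` is linear, this forces the part of
  lowest weight of the linear part of `E t` to have a kernel that is invariant under `g`. As this
  holds for all transvections, the kernel is zero and there is only one weight.
* Consequently the weights of `E t` on `𝔪 / 𝔪 ^ (k + 1)` are `t ^ (a * j)` for `1 ≤ j ≤ k`
  (`exists_jet_map_dilation_eq_sum`), and all coordinates of `E t` are polynomials in `t ^ a`.
* As the inverse of `φ` is regular, `t` is a rational function of `t ^ a`, hence `a = 1` or
  `a = -1` (`exists_linearPart_map_dilation_eq_one_or_neg_one`). In dimension one both signs occur.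

For `f` in `H_N`, the conjugates of `φ f` by `E t` are congruent to the identity modulo
`t ^ (N - 1)`. The difference between their action on `𝔪 / 𝔪 ^ N` and the identity is a Laurent
polynomial in `t` with exponents `a * (i - j)`, `1 ≤ i, j ≤ N - 1`. These are less than `N - 1` in
absolute value, so the difference vanishes and `φ f` is in `H_N` (`map_mem_augSubgroup`). The statement
over `K` follows, since `φ` is defined over `K` and therefore maps automorphisms with coefficients
in `K` to such automorphisms.
-/

noncomputable section

namespace PolyAut

/-! ### Rational functions on the punctured line -/

/-- The functions on `Lˣ` that are given by a rational function without pole at `t₀`. The point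
`t₀ = 0`, which lies outside of `Lˣ`, is allowed. At the zeros of the denominator `Q` the equation
does not determine the value of the function. -/
def rationalAt {L : Type*} [Field L] (t₀ : L) : Subalgebra L (Lˣ → L) where
  carrier := {u | ∃ P Q : Polynomial L, Q.eval t₀ ≠ 0 ∧ ∀ t : Lˣ, u t * Q.eval ↑t = P.eval ↑t}
  mul_mem' := by
    rintro u v ⟨P, Q, hQ, h⟩ ⟨P', Q', hQ', h'⟩
    refine ⟨P * P', Q * Q', by simp [hQ, hQ'], fun t => ?_⟩
    rw [Polynomial.eval_mul, Polynomial.eval_mul, ← h, ← h', Pi.mul_apply]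
    ring
  add_mem' := by
    rintro u v ⟨P, Q, hQ, h⟩ ⟨P', Q', hQ', h'⟩
    refine ⟨P * Q' + P' * Q, Q * Q', by simp [hQ, hQ'], fun t => ?_⟩
    simp only [Polynomial.eval_mul, Polynomial.eval_add, ← h, ← h', Pi.add_apply]
    ring
  algebraMap_mem' := fun c => ⟨Polynomial.C c, 1, by simp, fun t => by simp⟩

theorem mem_rationalAt {L : Type*} [Field L] {t₀ : L} {u : Lˣ → L} : u ∈ rationalAt t₀ ↔
    ∃ P Q : Polynomial L, Q.eval t₀ ≠ 0 ∧ ∀ t : Lˣ, u t * Q.eval ↑t = P.eval ↑t :=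
  Iff.rfl

theorem polynomial_eq_of_eval_units {L : Type*} [Field L] [Infinite L] {P Q : Polynomial L}
    (h : ∀ t : Lˣ, P.eval ↑t = Q.eval ↑t) : P = Q := by
  have h1 : Polynomial.X * P = Polynomial.X * Q := by
    refine Polynomial.funext fun t => ?_
    rcases eq_or_ne t 0 with rfl | ht
    · simp
    · simpa [ht] using h (Units.mk0 t ht)
  exact mul_left_cancel₀ Polynomial.X_ne_zero h1

theorem exists_unit_eval_ne_zero {L : Type*} [Field L] [Infinite L] {P : Polynomial L}
    (hP : P ≠ 0) : ∃ t : Lˣ, P.eval ↑t ≠ 0 := by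
  by_contra! h
  exact hP (polynomial_eq_of_eval_units fun t => by simp [h t])

/-- Finitely many functions that are rational at `t₀` have a common denominator. -/
theorem exists_common_denominator {L ι : Type*} [Field L] [Finite ι] {t₀ : L}
    {u : ι → Lˣ → L} (hu : ∀ i, u i ∈ rationalAt t₀) :
    ∃ (P : ι → Polynomial L) (Q : Polynomial L), Q.eval t₀ ≠ 0 ∧
      ∀ i (t : Lˣ), u i t * Q.eval ↑t = (P i).eval ↑t := by
  classical
  cases nonempty_fintype ι
  choose P Q hQ h using fun i => mem_rationalAt.1 (hu i)
  refine ⟨fun i => P i * ∏ j ∈ Finset.univ.erase i, Q j, ∏ j, Q j, ?_, fun i t => ?_⟩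
  · rw [Polynomial.eval_prod]
    exact Finset.prod_ne_zero_iff.2 fun j _ => hQ j
  · rw [← Finset.mul_prod_erase _ _ (Finset.mem_univ i), Polynomial.eval_mul, Polynomial.eval_mul,
      ← mul_assoc, h]

/-- Distinct powers are distinct characters of `Lˣ`. -/
theorem zpow_unit_injective {L : Type*} [Field L] [Infinite L] {a b : ℤ}
    (h : ∀ t : Lˣ, t ^ a = t ^ b) : a = b := by
  wlog hab : a ≤ b generalizing a b
  · exact (this (fun t => (h t).symm) (le_of_not_ge hab)).symm
  obtain ⟨k, rfl⟩ := Int.le.dest hab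
  have h1 : (1 : Polynomial L) = Polynomial.X ^ k := by
    refine polynomial_eq_of_eval_units fun t => ?_
    have := h t
    rw [zpow_add, left_eq_mul, zpow_natCast] at this
    simp [← Units.val_pow_eq_pow_val, this]
  have h2 := congrArg Polynomial.natDegree h1
  simp only [Polynomial.natDegree_one, Polynomial.natDegree_X_pow] at h2
  simp [← h2]

/-- A finite set of exponents is separated by a single element of the infinite field. -/
theorem exists_unit_injOn_pow {L : Type*} [Field L] [Infinite L] (s : Finset ℕ) :
    ∃ t : Lˣ, Set.InjOn (fun l : ℕ => (t : L) ^ l) s := by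
  classical
  let p : Polynomial L := ∏ x ∈ s ×ˢ s with x.1 ≠ x.2,
    (Polynomial.X ^ x.1 - Polynomial.X ^ x.2)
  have hp : p ≠ 0 := by
    refine Finset.prod_ne_zero_iff.2 fun x hx h => (Finset.mem_filter.1 hx).2 ?_
    have := congrArg Polynomial.natDegree (sub_eq_zero.1 h)
    simpa using this
  obtain ⟨t, ht⟩ := exists_unit_eval_ne_zero hp
  refine ⟨t, fun a ha b hb hab => by_contra fun hne => ?_⟩
  rw [Polynomial.eval_prod, Finset.prod_ne_zero_iff] at ht
  refine ht (a, b) (by simp_all) ?_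
  simpa [sub_eq_zero] using hab

/-! ### Rational representations of the multiplicative group -/

/-- The expansion at `0` of a rational representation `R` of `Lˣ`: after multiplication by a power
of `t` it is a matrix of power series, each coefficient `S l` of which is a left eigenvector of all
`R(t)`. The power series have a common denominator `Q`. -/
theorem exists_powerSeries_expansion {L ι : Type*} [Field L] [Infinite L] [Fintype ι]
    [DecidableEq ι] (R : Lˣ →* Matrix ι ι L)
    (hR : ∀ i j, (fun t => R t i j) ∈ rationalAt (1 : L)) :
    ∃ (e : ℕ) (Q : Polynomial L) (P : ι → ι → Polynomial L) (S : ℕ → Matrix ι ι L), Q ≠ 0 ∧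
      (∀ i j, (P i j : PowerSeries L) = PowerSeries.mk (fun l => S l i j) * Q) ∧
      (∀ i j (t : Lˣ), R t i j * ((t : L) ^ e * Q.eval ↑t) = (P i j).eval ↑t) ∧
      ∀ l (t : Lˣ), (t : L) ^ e • (S l * R t) = (t : L) ^ l • S l := by
  obtain ⟨P, Q₀, hQ₀, hP⟩ := exists_common_denominator (t₀ := (1 : L))
    (u := fun (x : ι × ι) t => R t x.1 x.2) fun x => hR x.1 x.2
  have hQ₀' : Q₀ ≠ 0 := by rintro rfl; simp at hQ₀
  obtain ⟨Q, hQ, hdvd⟩ := Polynomial.exists_eq_pow_rootMultiplicity_mul_and_not_dvd Q₀ hQ₀' 0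
  set e := Q₀.rootMultiplicity 0 with he
  rw [map_zero, sub_zero] at hQ hdvd
  have hQ0 : PowerSeries.constantCoeff (Q : PowerSeries L) ≠ 0 := by
    rw [Polynomial.constantCoeff_coe]
    exact fun h => hdvd (Polynomial.X_dvd_iff.2 h)
  have hQne : Q ≠ 0 := by rintro rfl; simp at hdvd
  let S : ι → ι → PowerSeries L := fun i j => (P (i, j) : PowerSeries L) * (Q : PowerSeries L)⁻¹
  have hS : ∀ i j, (P (i, j) : PowerSeries L) = S i j * Q := fun i j => by
    simp only [S]
    rw [mul_assoc, PowerSeries.inv_mul_cancel _ hQ0, mul_one]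
  refine ⟨e, Q, fun i j => P (i, j), fun l => Matrix.of fun i j => PowerSeries.coeff l (S i j),
    hQne, fun i j => ?_, fun i j t => ?_, fun l t => ?_⟩
  · rw [hS]
    congr 1
    ext l
    simp
  · rw [← hP (i, j) t, hQ]
    simp
  · -- The identity `R(ts) = R(s) R(t)`, with denominators cleared, as polynomials in `s`.
    have key : ∀ i j, (P (i, j)).comp (Polynomial.C (t : L) * Polynomial.X) * Q₀
        = Q₀.comp (Polynomial.C (t : L) * Polynomial.X)
          * ∑ k, P (i, k) * Polynomial.C (R t k j) := by
      intro i j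
      refine polynomial_eq_of_eval_units fun s => ?_
      have h1 := hP (i, j) (t * s)
      have h2 : R (t * s) i j = ∑ k, R s i k * R t k j := by
        rw [mul_comm, map_mul, Matrix.mul_apply]
      simp only [Polynomial.eval_mul, Polynomial.eval_comp, Polynomial.eval_C,
        Polynomial.eval_X, Polynomial.eval_finsetSum, ← hP]
      rw [Units.val_mul] at h1
      rw [← h1, h2, Finset.sum_mul, Finset.sum_mul, Finset.mul_sum]
      refine Finset.sum_congr rfl fun k _ => ?_
      ring
    have hres : ∀ p : Polynomial L,
        ((p.comp (Polynomial.C (t : L) * Polynomial.X) : Polynomial L) : PowerSeries L)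
        = PowerSeries.rescale (t : L) p := by
      intro p
      ext m
      rw [Polynomial.coeff_coe, Polynomial.comp_C_mul_X_coeff, PowerSeries.coeff_rescale,
        Polynomial.coeff_coe, mul_comm]
    have key2 : ∀ i j, PowerSeries.rescale (t : L) (S i j)
        = PowerSeries.C ((t : L) ^ e) * ∑ k, S i k * PowerSeries.C (R t k j) := by
      intro i j
      have h := congrArg (fun p : Polynomial L => (p : PowerSeries L)) (key i j)
      simp only [Polynomial.coe_mul, hres] at h
      have hsum : ((∑ k, P (i, k) * Polynomial.C (R t k j) : Polynomial L) : PowerSeries L)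
          = (∑ k, S i k * PowerSeries.C (R t k j)) * Q := by
        rw [← Polynomial.coeToPowerSeries.ringHom_apply, map_sum, Finset.sum_mul]
        refine Finset.sum_congr rfl fun k _ => ?_
        rw [Polynomial.coeToPowerSeries.ringHom_apply, Polynomial.coe_mul, hS, Polynomial.coe_C]
        ring
      rw [hsum, hS, map_mul, hQ] at h
      simp only [Polynomial.coe_mul, Polynomial.coe_pow, Polynomial.coe_X, map_mul, map_pow,
        PowerSeries.rescale_X] at h
      have hne : PowerSeries.rescale (t : L) (Q : PowerSeries L)
          * (PowerSeries.X ^ e * (Q : PowerSeries L)) ≠ 0 := by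
        refine mul_ne_zero ?_ (mul_ne_zero (pow_ne_zero _ PowerSeries.X_ne_zero) ?_)
        · rw [Ne, map_eq_zero_iff _ (PowerSeries.rescale_injective t.ne_zero)]
          exact fun h => hQne (Polynomial.coe_eq_zero_iff.1 h)
        · exact fun h => hQne (Polynomial.coe_eq_zero_iff.1 h)
      refine mul_right_cancel₀ hne ?_
      rw [map_pow]
      linear_combination h
    ext i j
    have h := congrArg (PowerSeries.coeff l) (key2 i j)
    rw [PowerSeries.coeff_rescale, PowerSeries.coeff_C_mul, map_sum] at h
    simp only [PowerSeries.coeff_mul_C] at h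
    simp only [Matrix.smul_apply, Matrix.mul_apply, Matrix.of_apply, smul_eq_mul]
    exact h.symm

/-- Every rational representation of the multiplicative group is the sum of its weight parts `W l`,
`l ∈ s`. -/
theorem exists_weight_decomposition {L ι : Type*} [Field L] [Infinite L] [Fintype ι]
    [DecidableEq ι] (R : Lˣ →* Matrix ι ι L)
    (hR : ∀ i j, (fun t => R t i j) ∈ rationalAt (1 : L)) :
    ∃ (s : Finset ℤ) (W : ℤ → Matrix ι ι L), (∀ l ∈ s, W l ≠ 0) ∧
      (∀ t : Lˣ, R t = ∑ l ∈ s, ((t ^ l : Lˣ) : L) • W l) ∧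
      ∀ l ∈ s, ∀ t : Lˣ, W l * R t = ((t ^ l : Lˣ) : L) • W l := by
  classical
  obtain ⟨e, Q, P, S, hQ, hPS, hRP, hS⟩ := exists_powerSeries_expansion R hR
  have hS' : ∀ (l : ℕ) (t : Lˣ), S l * R t = ((t ^ (l - e : ℤ) : Lˣ) : L) • S l := by
    intro l t
    rw [zpow_sub, zpow_natCast, zpow_natCast, Units.val_mul, mul_comm, mul_smul]
    rw [Units.val_pow_eq_pow_val, ← hS, smul_smul, ← Units.val_pow_eq_pow_val, Units.inv_mul,
      one_smul]
  -- Distinct `l` with `S l ≠ 0` give distinct eigenvalues of one matrix `R(t)`.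
  have hfin : {l | S l ≠ 0}.Finite := by
    by_contra hinf
    obtain ⟨F, hF, hcard⟩ := Set.Infinite.exists_subset_card_eq hinf (Fintype.card ι + 1)
    obtain ⟨t, ht⟩ := exists_unit_injOn_pow (L := L) F
    let ev : ℕ → L := fun l => ((t ^ (l - e : ℤ) : Lˣ) : L)
    have hev : Set.InjOn ev F := by
      intro a ha b hb hab
      have h1 : (t ^ (a - e : ℤ) : Lˣ) = t ^ (b - e : ℤ) := Units.ext hab
      rw [zpow_sub, zpow_sub, mul_left_inj, zpow_natCast, zpow_natCast] at h1
      exact ht ha hb (by simpa using congrArg Units.val h1)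
    have hroot : F.image ev ⊆ (R t).charpoly.roots.toFinset := by
      intro x hx
      obtain ⟨l, hl, rfl⟩ := Finset.mem_image.1 hx
      rw [Multiset.mem_toFinset, Polynomial.mem_roots (Matrix.charpoly_monic _).ne_zero,
        Polynomial.IsRoot.def, Matrix.eval_charpoly]
      by_contra hdet
      have h0 : S l * (Matrix.scalar ι (ev l) - R t) = 0 := by
        rw [Matrix.mul_sub, hS', sub_eq_zero, Matrix.scalar_apply, ← Matrix.smul_one_eq_diagonal,
          Matrix.mul_smul, Matrix.mul_one]
      have hu : IsUnit (Matrix.scalar ι (ev l) - R t) :=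
        (Matrix.isUnit_iff_isUnit_det _).2 (isUnit_iff_ne_zero.2 hdet)
      exact hF hl (hu.mul_left_eq_zero.1 h0)
    have h1 := Finset.card_le_card hroot
    rw [Finset.card_image_of_injOn hev, hcard] at h1
    have h2 := (Multiset.toFinset_card_le _).trans ((R t).charpoly.card_roots')
    rw [Matrix.charpoly_natDegree_eq_dim] at h2
    omega
  have hPpoly : ∀ i j (t : L),
      (P i j).eval t = (∑ l ∈ hfin.toFinset, S l i j * t ^ l) * Q.eval t := by
    intro i j t
    have h1 : P i j = (∑ l ∈ hfin.toFinset, Polynomial.monomial l (S l i j)) * Q := by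
      apply Polynomial.coe_injective
      rw [hPS, Polynomial.coe_mul]
      congr 1
      ext m
      rw [PowerSeries.coeff_mk, Polynomial.coeff_coe, Polynomial.finsetSum_coeff]
      simp only [Polynomial.coeff_monomial, Finset.sum_ite_eq', Set.Finite.mem_toFinset]
      split_ifs with hm
      · rfl
      · rw [Set.mem_ofPred_eq, not_not] at hm
        rw [hm, Matrix.zero_apply]
    rw [h1, Polynomial.eval_mul, Polynomial.eval_finsetSum]
    simp
  -- At all points with `Q(t) ≠ 0` the expansion gives the value of `R`.
  have hgen : ∀ t : Lˣ, Q.eval ↑t ≠ 0 →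
      R t = ∑ l ∈ hfin.toFinset, ((t ^ (l - e : ℤ) : Lˣ) : L) • S l := by
    intro t ht
    ext i j
    have h1 := hRP i j t
    rw [hPpoly, ← mul_assoc] at h1
    have h2 := mul_right_cancel₀ ht h1
    have h3 : (t : L) ^ e ≠ 0 := pow_ne_zero _ t.ne_zero
    refine mul_right_cancel₀ h3 ?_
    rw [h2, Matrix.sum_apply, Finset.sum_mul]
    refine Finset.sum_congr rfl fun l _ => ?_
    rw [Matrix.smul_apply, smul_eq_mul, zpow_sub, zpow_natCast, zpow_natCast, Units.val_mul,
      mul_right_comm, mul_assoc ((t ^ l : Lˣ) : L), ← Units.val_pow_eq_pow_val t e, Units.inv_mul,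
      mul_one, Units.val_pow_eq_pow_val, mul_comm]
  refine ⟨hfin.toFinset.image fun l : ℕ => (l - e : ℤ), fun l => S (l + e).toNat, ?_, fun t => ?_,
    ?_⟩
  · intro l hl
    obtain ⟨m, hm, rfl⟩ := Finset.mem_image.1 hl
    simpa using hm
  · rw [Finset.sum_image fun a _ b _ h => by simpa using h]
    simp only [sub_add_cancel, Int.toNat_natCast]
    -- A translate of `t` by some `v` avoids the zeros of `Q`.
    have hne : Q * Q.comp (Polynomial.C (t : L) * Polynomial.X) ≠ 0 := by
      refine mul_ne_zero hQ fun h => hQ ?_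
      rw [← Polynomial.comp_C_mul_X_eq_zero_iff (r := (t : L))]
      · exact h
      · exact mem_nonZeroDivisors_of_ne_zero t.ne_zero
    obtain ⟨v, hv⟩ := exists_unit_eval_ne_zero hne
    simp only [Polynomial.eval_mul, Polynomial.eval_comp, Polynomial.eval_C,
      Polynomial.eval_X] at hv
    have h1 := hgen (t * v) (by rw [Units.val_mul]; exact right_ne_zero_of_mul hv)
    have h2 : R t = R (t * v) * R v⁻¹ := by rw [← map_mul]; simp
    rw [h2, h1, Finset.sum_mul]
    refine Finset.sum_congr rfl fun l _ => ?_
    rw [Matrix.smul_mul, hS', smul_smul, ← Units.val_mul, mul_zpow, inv_zpow, mul_assoc,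
      mul_inv_cancel, mul_one]
  · intro l hl t
    obtain ⟨m, hm, rfl⟩ := Finset.mem_image.1 hl
    simpa using hS' m t

/-! ### Automorphisms acting on jets -/

theorem coord_eq_zero_of_degree_eq_zero {L : Type*} [Field L] {n : ℕ} (f : Aut0 L n) (i : Fin n)
    {m : Fin n →₀ ℕ} (hm : m.degree = 0) : coord f (i, m) = 0 := by
  rw [Finsupp.degree_eq_zero_iff] at hm
  subst hm
  have h := constantCoeff_apply f.1 f.2 (X i)
  rw [constantCoeff_X] at h
  exact h

theorem mem_degreeLE_iff {L : Type*} [Field L] {n d : ℕ} {f : Aut0 L n} :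
    f ∈ degreeLE L n d ↔ ∀ i (m : Fin n →₀ ℕ), d < m.degree → coord f (i, m) = 0 := by
  refine forall_congr' fun i => ⟨fun h m hm => ?_, fun h => Finset.sup_le fun m hm => ?_⟩
  · exact coeff_eq_zero_of_totalDegree_lt (lt_of_le_of_lt h hm)
  · by_contra! hlt
    exact (mem_support_iff.1 hm) (h m hlt)

theorem exists_mem_degreeLE {L : Type*} [Field L] {n : ℕ} (f : Aut0 L n) :
    ∃ d, 1 ≤ d ∧ f ∈ degreeLE L n d := by
  refine ⟨max 1 (Finset.univ.sup fun i => (f.1 (X i)).totalDegree), le_max_left _ _, fun i => ?_⟩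
  exact le_max_of_le_right
    (Finset.le_sup (f := fun i => (f.1 (X i)).totalDegree) (Finset.mem_univ i))

theorem aut0_ext {L : Type*} [Field L] {n : ℕ} {f g : Aut0 L n}
    (h : ∀ i, f.1 (X i) = g.1 (X i)) : f = g := by
  refine Subtype.ext (AlgEquiv.coe_toAlgHom_injective ?_)
  exact MvPolynomial.algHom_ext h

theorem mem_augSubgroup_iff {L : Type*} [Field L] {n N : ℕ} {f : Aut0 L n} :
    f ∈ augSubgroup L n N ↔
      ∀ i (m : Fin n →₀ ℕ), m.degree < N → coord f (i, m) = coord (1 : Aut0 L n) (i, m) := by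
  refine forall_congr' fun i => ?_
  rw [mem_pow_idealOfVars_iff']
  refine forall_congr' fun m => forall_congr' fun _ => ?_
  rw [coeff_sub, sub_eq_zero]
  rfl

theorem monomial_mem_augIdeal_pow {L : Type*} [Field L] {n : ℕ} (m : Fin n →₀ ℕ) (c : L) :
    monomial m c ∈ augIdeal L n ^ m.degree := by
  classical
  rw [mem_pow_idealOfVars_iff']
  intro x hx
  rw [coeff_monomial, if_neg]
  rintro rfl
  exact lt_irrefl _ hx

theorem coeff_apply_monomial_of_degree_lt {L : Type*} [Field L] {n : ℕ} (f : Aut0 L n)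
    {m m' : Fin n →₀ ℕ} (h : m.degree < m'.degree) : coeff m (f.1 (monomial m' 1)) = 0 :=
  (mem_pow_idealOfVars_iff' _ _).1 (map_pow_mem f _ (monomial_mem_augIdeal_pow m' 1)) m h

/-- The exponents of the monomials that span `𝔪 / 𝔪 ^ (k + 1)`, for the augmentation ideal `𝔪`. -/
def jetExponents (n k : ℕ) : Finset (Fin n →₀ ℕ) :=
  (Finsupp.finite_of_degree_le k).toFinset.filter fun m => 1 ≤ m.degree

theorem mem_jetExponents {n k : ℕ} {m : Fin n →₀ ℕ} :
    m ∈ jetExponents n k ↔ 1 ≤ m.degree ∧ m.degree ≤ k := by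
  simp [jetExponents, and_comm]

theorem single_mem_jetExponents {n k : ℕ} (hk : 1 ≤ k) (i : Fin n) :
    Finsupp.single i 1 ∈ jetExponents n k := by
  simp [mem_jetExponents, hk]

/-- The action of an automorphism on the jet of a polynomial is determined by its action on the
monomials of degree between `1` and `k`. -/
theorem coeff_apply_eq_sum {L : Type*} [Field L] {n k : ℕ} (f : Aut0 L n)
    (p : MvPolynomial (Fin n) L) {m : Fin n →₀ ℕ} (hm : m ∈ jetExponents n k) :
    coeff m (f.1 p) = ∑ m' ∈ jetExponents n k, coeff m (f.1 (monomial m' 1)) * coeff m' p := by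
  classical
  rw [mem_jetExponents] at hm
  conv_lhs => rw [p.as_sum]
  have h1 : ∀ m', coeff m (f.1 (monomial m' (coeff m' p)))
      = coeff m (f.1 (monomial m' 1)) * coeff m' p := by
    intro m'
    have : monomial m' (coeff m' p) = coeff m' p • monomial m' 1 := by simp [smul_monomial]
    rw [this, map_smul, coeff_smul, smul_eq_mul, mul_comm]
  rw [map_sum, coeff_sum]
  simp only [h1]
  rw [Finset.sum_subset (Finset.subset_union_left (s₂ := jetExponents n k))]
  · refine (Finset.sum_subset Finset.subset_union_right fun m' _ hm' => ?_).symm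
    rw [mem_jetExponents, not_and_or, not_le, not_le, Nat.lt_one_iff] at hm'
    rcases hm' with h0 | hlt
    · rw [Finsupp.degree_eq_zero_iff] at h0
      have hm0 : m ≠ 0 := by
        rintro rfl
        simp at hm
      rw [h0, monomial_zero', C_1, map_one, coeff_one, if_neg hm0.symm, zero_mul]
    · rw [coeff_apply_monomial_of_degree_lt f (hm.2.trans_lt hlt), zero_mul]
  · intro m' _ hm'
    rw [notMem_support_iff.1 hm', mul_zero]

theorem coeff_mul_apply_eq_sum {L : Type*} [Field L] {n : ℕ} (f g : Aut0 L n) {k : ℕ}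
    {m : Fin n →₀ ℕ} (hm : m ∈ jetExponents n k) (p : MvPolynomial (Fin n) L) :
    coeff m ((f * g).1 p) =
      ∑ m' ∈ jetExponents n k, coeff m (f.1 (monomial m' 1)) * coeff m' (g.1 p) := by
  rw [← coeff_apply_eq_sum f _ hm]
  rfl

/-- The action of an automorphism on `𝔪 / 𝔪 ^ (k + 1)`, where `𝔪` is the augmentation ideal, as a
matrix with respect to the basis of monomials. -/
def jet (L : Type*) [Field L] (n k : ℕ) :
    Aut0 L n →* Matrix (jetExponents n k) (jetExponents n k) L where
  toFun f := Matrix.of fun m m' => coeff m.1 (f.1 (monomial m'.1 1))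
  map_one' := by
    classical
    ext m m'
    change coeff m.1 (monomial m'.1 1) = _
    rw [coeff_monomial, Matrix.one_apply]
    exact if_congr (by rw [Subtype.ext_iff, eq_comm]) rfl rfl
  map_mul' f g := by
    ext m m'
    rw [Matrix.of_apply, coeff_mul_apply_eq_sum f g m.2, Matrix.mul_apply, ← Finset.sum_coe_sort]
    rfl

theorem jet_apply_single {L : Type*} [Field L] {n k : ℕ} (hk : 1 ≤ k) (f : Aut0 L n)
    (m : jetExponents n k) (i : Fin n) :
    jet L n k f m ⟨Finsupp.single i 1, single_mem_jetExponents hk i⟩ = coord f (i, m.1) :=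
  rfl

theorem exists_eq_single_of_degree_eq_one {n : ℕ} {m : Fin n →₀ ℕ} (h : m.degree = 1) :
    ∃ i, m = Finsupp.single i 1 := by
  have hm : m ≠ 0 := by rintro rfl; simp at h
  obtain ⟨i, hi⟩ := Finsupp.ne_iff.1 hm
  have hle : Finsupp.single i 1 ≤ m :=
    Finsupp.single_le_iff.2 (Nat.one_le_iff_ne_zero.2 hi)
  obtain ⟨c, rfl⟩ := exists_add_of_le hle
  refine ⟨i, ?_⟩
  rw [map_add, Finsupp.degree_single, Nat.add_eq_left, Finsupp.degree_eq_zero_iff] at h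
  rw [h, add_zero]

theorem single_one_injective {n : ℕ} :
    Function.Injective fun i : Fin n => Finsupp.single i (1 : ℕ) :=
  Finsupp.single_left_injective one_ne_zero

/-- The linear part of an automorphism, as a matrix. -/
def linearPart (L : Type*) [Field L] (n : ℕ) : Aut0 L n →* Matrix (Fin n) (Fin n) L where
  toFun f := Matrix.of fun j i => coord f (i, Finsupp.single j 1)
  map_one' := by
    classical
    ext j i
    simp [coord, Matrix.one_apply, coeff_X, single_one_injective.eq_iff, eq_comm]
  map_mul' f g := by
    classical
    ext j i
    have h1 : jetExponents n 1 = Finset.univ.image fun i => Finsupp.single i (1 : ℕ) := by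
      ext m
      rw [mem_jetExponents, Finset.mem_image]
      constructor
      · rintro ⟨h, h'⟩
        obtain ⟨i, rfl⟩ := exists_eq_single_of_degree_eq_one (le_antisymm h' h)
        exact ⟨i, Finset.mem_univ i, rfl⟩
      · rintro ⟨i, -, rfl⟩
        simp
    have h2 := coeff_mul_apply_eq_sum f g (single_mem_jetExponents le_rfl j) (X i)
    rw [h1, Finset.sum_image single_one_injective.injOn] at h2
    exact h2

theorem linearPart_apply {L : Type*} [Field L] {n : ℕ} (f : Aut0 L n) (i j : Fin n) :
    linearPart L n f j i = coord f (i, Finsupp.single j 1) :=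
  rfl

/-- If the linear part is multiplication by `c`, then the part of degree `k` of the action on
`𝔪 ^ k` is multiplication by `c ^ k`. -/
theorem coeff_apply_monomial_of_linearPart {L : Type*} [Field L] {n : ℕ} {f : Aut0 L n} {c : L}
    (hf : linearPart L n f = c • 1) {m m' : Fin n →₀ ℕ} (hm : m.degree = m'.degree) :
    coeff m (f.1 (monomial m' 1)) = if m = m' then c ^ m'.degree else 0 := by
  classical
  have add : ∀ a b : Fin n →₀ ℕ,
      f.1 (monomial a 1) - c ^ a.degree • monomial a 1 ∈ augIdeal L n ^ (a.degree + 1) →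
      f.1 (monomial b 1) - c ^ b.degree • monomial b 1 ∈ augIdeal L n ^ (b.degree + 1) →
      f.1 (monomial (a + b) 1) - c ^ (a + b).degree • monomial (a + b) 1
        ∈ augIdeal L n ^ ((a + b).degree + 1) := by
    intro a b ha hb
    have hab : (monomial (a + b) 1 : MvPolynomial (Fin n) L) = monomial a 1 * monomial b 1 := by
      simp
    have h1 : f.1 (monomial (a + b) 1) - c ^ (a + b).degree • monomial (a + b) 1
        = f.1 (monomial a 1) * (f.1 (monomial b 1) - c ^ b.degree • monomial b 1)
          + (f.1 (monomial a 1) - c ^ a.degree • monomial a 1)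
            * (c ^ b.degree • monomial b 1) := by
      rw [hab, map_mul, map_add, pow_add]
      simp only [smul_eq_C_mul, C_mul]
      ring
    rw [h1, map_add]
    refine Ideal.add_mem _ ?_ ?_
    · rw [add_assoc, pow_add]
      exact Ideal.mul_mem_mul (map_pow_mem f _ (monomial_mem_augIdeal_pow a 1)) hb
    · rw [add_right_comm, pow_add]
      refine Ideal.mul_mem_mul ha ?_
      rw [smul_eq_C_mul]
      exact Ideal.mul_mem_left _ _ (monomial_mem_augIdeal_pow b 1)
  have zero : f.1 (monomial 0 1) - c ^ (0 : Fin n →₀ ℕ).degree • monomial 0 1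
      ∈ augIdeal L n ^ ((0 : Fin n →₀ ℕ).degree + 1) := by
    have h1 : (monomial (0 : Fin n →₀ ℕ) 1 : MvPolynomial (Fin n) L) = 1 := rfl
    rw [h1, map_one, map_zero, pow_zero, one_smul, sub_self]
    exact Ideal.zero_mem _
  have one : ∀ i : Fin n, f.1 (monomial (Finsupp.single i 1) 1)
      - c ^ (Finsupp.single i 1 : Fin n →₀ ℕ).degree • monomial (Finsupp.single i 1) 1
      ∈ augIdeal L n ^ ((Finsupp.single i 1 : Fin n →₀ ℕ).degree + 1) := by
    intro i
    rw [Finsupp.degree_single, mem_pow_idealOfVars_iff']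
    intro x hx
    rw [coeff_sub, coeff_smul, coeff_monomial]
    change coord f (i, x) - _ = _
    rcases Nat.lt_or_ge x.degree 1 with h0 | h1
    · rw [coord_eq_zero_of_degree_eq_zero f i (by omega), if_neg, smul_zero, sub_zero]
      rintro rfl
      simp at h0
    · obtain ⟨j, rfl⟩ := exists_eq_single_of_degree_eq_one (m := x) (by omega)
      rw [← linearPart_apply, hf, Matrix.smul_apply, Matrix.one_apply, pow_one]
      simp [single_one_injective.eq_iff, eq_comm]
  have key : ∀ a : Fin n →₀ ℕ,
      f.1 (monomial a 1) - c ^ a.degree • monomial a 1 ∈ augIdeal L n ^ (a.degree + 1) := by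
    intro a
    induction a using Finsupp.induction_linear with
    | zero => exact zero
    | add a b ha hb => exact add a b ha hb
    | single i k =>
      induction k with
      | zero => rw [Finsupp.single_zero]; exact zero
      | succ k ih => rw [Finsupp.single_add]; exact add _ _ ih (one i)
  have h := (mem_pow_idealOfVars_iff' _ _).1 (key m') m (by omega)
  rw [coeff_sub, sub_eq_zero] at h
  rw [h, coeff_smul, coeff_monomial]
  simp [eq_comm]

/-! ### Linear automorphisms -/

/-- The algebra endomorphism with `X i ↦ ∑ j, A j i • X j`. -/
def linearHom {L : Type*} [Field L] {n : ℕ} (A : Matrix (Fin n) (Fin n) L) :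
    MvPolynomial (Fin n) L →ₐ[L] MvPolynomial (Fin n) L :=
  aeval fun i => ∑ j, A j i • X j

theorem linearHom_X {L : Type*} [Field L] {n : ℕ} (A : Matrix (Fin n) (Fin n) L) (i : Fin n) :
    linearHom A (X i) = ∑ j, A j i • X j := by
  simp [linearHom]

theorem linearHom_one {L : Type*} [Field L] {n : ℕ} :
    linearHom (1 : Matrix (Fin n) (Fin n) L) = AlgHom.id L _ := by
  refine MvPolynomial.algHom_ext fun i => ?_
  simp [linearHom_X, Matrix.one_apply]

theorem linearHom_comp {L : Type*} [Field L] {n : ℕ} (A B : Matrix (Fin n) (Fin n) L) :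
    (linearHom A).comp (linearHom B) = linearHom (A * B) := by
  refine MvPolynomial.algHom_ext fun i => ?_
  simp only [AlgHom.comp_apply, linearHom_X, map_sum, map_smul, Matrix.mul_apply, Finset.smul_sum,
    Finset.sum_smul, smul_smul]
  rw [Finset.sum_comm]
  simp only [mul_comm]

/-- The linear automorphisms, as a homomorphism from the group of invertible matrices. -/
def linearAut (L : Type*) [Field L] (n : ℕ) : (Matrix (Fin n) (Fin n) L)ˣ →* Aut0 L n where
  toFun A := ⟨AlgEquiv.ofAlgHom (linearHom A) (linearHom ↑A⁻¹)
      (by rw [linearHom_comp, Units.mul_inv, linearHom_one])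
      (by rw [linearHom_comp, Units.inv_mul, linearHom_one]), by
    have h : augIdeal L n ≤ (augIdeal L n).comap (linearHom (A : Matrix (Fin n) (Fin n) L)) := by
      refine Ideal.span_le.2 ?_
      rintro _ ⟨i, rfl⟩
      rw [SetLike.mem_coe, Ideal.mem_comap, linearHom_X]
      refine Ideal.sum_mem _ fun j _ => ?_
      rw [smul_eq_C_mul]
      exact Ideal.mul_mem_left _ _ (Ideal.subset_span ⟨j, rfl⟩)
    exact fun p hp => h hp⟩
  map_one' := aut0_ext fun i => by
    change linearHom (1 : Matrix (Fin n) (Fin n) L) (X i) = X i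
    rw [linearHom_one]
    rfl
  map_mul' A B := aut0_ext fun i => by
    change linearHom (A * B : Matrix (Fin n) (Fin n) L) (X i)
      = linearHom (A : Matrix (Fin n) (Fin n) L) (linearHom (B : Matrix (Fin n) (Fin n) L) (X i))
    rw [← linearHom_comp]
    rfl

theorem linearAut_X {L : Type*} [Field L] {n : ℕ} (A : (Matrix (Fin n) (Fin n) L)ˣ) (i : Fin n) :
    (linearAut L n A).1 (X i) = ∑ j, A.1 j i • X j :=
  linearHom_X _ _

theorem coord_linearAut_single {L : Type*} [Field L] {n : ℕ} (A : (Matrix (Fin n) (Fin n) L)ˣ)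
    (i j : Fin n) : coord (linearAut L n A) (i, Finsupp.single j 1) = A.1 j i := by
  classical
  simp [coord, linearAut_X, coeff_sum, coeff_X, single_one_injective.eq_iff]

theorem coord_linearAut_of_degree_ne_one {L : Type*} [Field L] {n : ℕ}
    (A : (Matrix (Fin n) (Fin n) L)ˣ) (i : Fin n) {m : Fin n →₀ ℕ} (hm : m.degree ≠ 1) :
    coord (linearAut L n A) (i, m) = 0 := by
  classical
  simp only [coord, linearAut_X, coeff_sum, coeff_smul, coeff_X]
  refine Finset.sum_eq_zero fun j _ => ?_
  rw [if_neg, smul_zero]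
  rintro rfl
  simp at hm

theorem linearPart_linearAut {L : Type*} [Field L] {n : ℕ} (A : (Matrix (Fin n) (Fin n) L)ˣ) :
    linearPart L n (linearAut L n A) = A := by
  ext j i
  rw [linearPart_apply, coord_linearAut_single]

theorem linearAut_mem_degreeLE {L : Type*} [Field L] {n d : ℕ} (hd : 1 ≤ d)
    (A : (Matrix (Fin n) (Fin n) L)ˣ) : linearAut L n A ∈ degreeLE L n d :=
  mem_degreeLE_iff.2 fun i _ hm => coord_linearAut_of_degree_ne_one A i (by omega)

/-- The dilations `X i ↦ t • X i`. -/
def dilation (L : Type*) [Field L] (n : ℕ) : Lˣ →* Aut0 L n :=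
  (linearAut L n).comp (Units.map (Matrix.scalar (Fin n)).toMonoidHom)

theorem dilation_X {L : Type*} [Field L] {n : ℕ} (t : Lˣ) (i : Fin n) :
    (dilation L n t).1 (X i) = (t : L) • X i := by
  refine (linearAut_X _ i).trans ?_
  simp [Matrix.diagonal_apply]

theorem coord_dilation {L : Type*} [Field L] {n : ℕ} (t : Lˣ) (q : Fin n × (Fin n →₀ ℕ)) :
    coord (dilation L n t) q = t * coord (1 : Aut0 L n) q := by
  rw [coord, dilation_X, coeff_smul]
  rfl

theorem dilation_mem_degreeLE {L : Type*} [Field L] {n : ℕ} (t : Lˣ) :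
    dilation L n t ∈ degreeLE L n 1 :=
  linearAut_mem_degreeLE le_rfl _

theorem coeff_dilation {L : Type*} [Field L] {n : ℕ} (t : Lˣ) (p : MvPolynomial (Fin n) L)
    (m : Fin n →₀ ℕ) : coeff m ((dilation L n t).1 p) = (t : L) ^ m.degree * coeff m p := by
  classical
  induction p using MvPolynomial.induction_on' with
  | monomial a c =>
    have h : (dilation L n t).1 (monomial a c) = monomial a (t ^ a.degree * c) := by
      rw [monomial_eq, map_mul, Finsupp.prod, map_prod]
      simp only [map_pow, dilation_X]
      simp only [smul_eq_C_mul, mul_pow, Finset.prod_mul_distrib, Finset.prod_pow_eq_pow_sum]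
      rw [monomial_eq, C_mul, C_pow, Finsupp.prod, Finsupp.degree_apply]
      have hC : (dilation L n t).1 (C c) = C c := (dilation L n t).1.commutes c
      rw [hC]
      ring
    rw [h, coeff_monomial, coeff_monomial]
    split_ifs with ham
    · rw [ham]
    · rw [mul_zero]
  | add p q hp hq => rw [map_add, coeff_add, hp, hq, coeff_add, mul_add]

/-- Conjugation by dilations scales the coefficients of degree `k` by `t ^ (k - 1)`. The coefficient
for `k = 0` vanishes, so the truncated subtraction does no harm. -/
theorem coord_dilation_conj {L : Type*} [Field L] {n : ℕ} (t : Lˣ) (f : Aut0 L n)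
    (i : Fin n) (m : Fin n →₀ ℕ) :
    coord (dilation L n t * f * (dilation L n t)⁻¹) (i, m)
      = (t : L) ^ (m.degree - 1) * coord f (i, m) := by
  rcases Nat.eq_zero_or_pos m.degree with h0 | h1
  · rw [coord_eq_zero_of_degree_eq_zero _ i h0, coord_eq_zero_of_degree_eq_zero _ i h0, mul_zero]
  · rw [← map_inv]
    change coeff m ((dilation L n t).1 (f.1 ((dilation L n t⁻¹).1 (X i)))) = _
    rw [coeff_dilation, dilation_X, map_smul, coeff_smul, smul_eq_mul, ← mul_assoc]
    congr 1
    obtain ⟨k, hk⟩ := Nat.exists_eq_add_of_le' h1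
    rw [hk, Nat.add_sub_cancel, pow_succ, mul_assoc, Units.mul_inv, mul_one]

theorem dilation_conj_mem_degreeLE {L : Type*} [Field L] {n d : ℕ} (t : Lˣ) {f : Aut0 L n}
    (hf : f ∈ degreeLE L n d) : dilation L n t * f * (dilation L n t)⁻¹ ∈ degreeLE L n d := by
  rw [mem_degreeLE_iff] at hf ⊢
  intro i m hm
  rw [coord_dilation_conj, hf i m hm, mul_zero]

/-! ### Regular functions along curves -/

theorem degreeLE_mono {L : Type*} [Field L] {n d d' : ℕ} (h : d ≤ d') :
    degreeLE L n d ⊆ degreeLE L n d' :=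
  fun _ hf i => (hf i).trans h

/-- Along a curve whose coordinates are polynomials `p q` in a parameter `t`, a regular function `F`
is a rational function of `t` without pole at the parameter `t₀` of a given point `a` of its domain.
If the coordinates are congruent modulo an ideal `I` to the coordinates of `a`, then the values of
`F` are congruent modulo `I` to the value at `a`. -/
theorem IsRegularOn.along_curve {K L : Type*} [Field K] [Field L] [Algebra K L] {n : ℕ}
    {S : Set (Aut0 L n)} {F : Aut0 L n → L} (hF : IsRegularOn K S F)
    (p : Fin n × (Fin n →₀ ℕ) → Polynomial L) {a : Aut0 L n} (ha : a ∈ S) (t₀ : L)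
    (hpa : ∀ q, coord a q = (p q).eval t₀) :
    ∃ P Q : Polynomial L, Q.eval t₀ ≠ 0 ∧
      (∀ b ∈ S, ∀ t, (∀ q, coord b q = (p q).eval t) → F b * Q.eval t = P.eval t) ∧
      ∀ I : Ideal (Polynomial L), (∀ q, p q - Polynomial.C (coord a q) ∈ I) →
        P - Polynomial.C (F a) * Q ∈ I := by
  obtain ⟨P, Q, hQ, h⟩ := hF a ha
  have hev : ∀ (b : Aut0 L n) (t : L), (∀ q, coord b q = (p q).eval t) →
      ∀ G : MvPolynomial (Fin n × (Fin n →₀ ℕ)) K, (aeval p G).eval t = aeval (coord b) G := by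
    intro b t hb G
    have h1 : ((Polynomial.aeval t).restrictScalars K).comp (aeval p) = aeval (coord b) := by
      refine MvPolynomial.algHom_ext fun q => ?_
      simp [hb q]
    rw [← h1]
    simp
  -- The additional factor in `P / Q` makes the equation true also where `Q` vanishes.
  refine ⟨aeval p P * aeval p Q, aeval p Q * aeval p Q, ?_, fun b hb t hbt => ?_, fun I hI => ?_⟩
  · rw [Polynomial.eval_mul, hev a t₀ hpa]
    exact mul_ne_zero hQ hQ
  · rw [Polynomial.eval_mul, Polynomial.eval_mul, hev b t hbt, hev b t hbt]
    rcases eq_or_ne (aeval (coord b) Q) 0 with h0 | h0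
    · rw [h0, mul_zero, mul_zero, mul_zero]
    · rw [h b hb h0]
      field_simp
  · have hmod : ∀ G : MvPolynomial (Fin n × (Fin n →₀ ℕ)) K,
        aeval p G - Polynomial.C (aeval (coord a) G) ∈ I := by
      intro G
      have h1 : (Ideal.Quotient.mkₐ K I).comp (aeval p) = ((Ideal.Quotient.mkₐ K I).comp
          ((Polynomial.CAlgHom : L →ₐ[L] Polynomial L).restrictScalars K)).comp
            (aeval (coord a)) := by
        refine MvPolynomial.algHom_ext fun q => ?_
        simpa using Ideal.Quotient.eq.2 (hI q)
      exact Ideal.Quotient.eq.1 (DFunLike.congr_fun h1 G)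
    have hval : aeval (coord a) P = F a * aeval (coord a) Q := by
      rw [h a ha hQ, div_mul_cancel₀ _ hQ]
    have h2 : aeval p P * aeval p Q - Polynomial.C (F a) * (aeval p Q * aeval p Q)
        = aeval p Q * ((aeval p P - Polynomial.C (aeval (coord a) P))
          - Polynomial.C (F a) * (aeval p Q - Polynomial.C (aeval (coord a) Q))) := by
      rw [hval, Polynomial.C_mul]
      ring
    rw [h2]
    exact Ideal.mul_mem_left _ _ (Ideal.sub_mem _ (hmod P) (Ideal.mul_mem_left _ _ (hmod Q)))

/-- An ind-morphism maps a polynomial curve of bounded degree to a curve with rational coordinates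
that have no pole where the limit of the original curve exists. -/
theorem IsIndMorphism.coord_mem_rationalAt {K L : Type*} [Field K] [Field L] [Algebra K L] {n : ℕ}
    {φ : Aut0 L n → Aut0 L n} (hφ : IsIndMorphism K φ) {d : ℕ}
    (p : Fin n × (Fin n →₀ ℕ) → Polynomial L) {a : Aut0 L n} (ha : a ∈ degreeLE L n d) {t₀ : L}
    (hpa : ∀ q, coord a q = (p q).eval t₀) {γ : Lˣ → Aut0 L n} (hγ : ∀ t, γ t ∈ degreeLE L n d)
    (hpγ : ∀ t q, coord (γ t) q = (p q).eval ↑t) (q : Fin n × (Fin n →₀ ℕ)) :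
    (fun t => coord (φ (γ t)) q) ∈ rationalAt t₀ := by
  obtain ⟨d', -, hreg⟩ := hφ d
  obtain ⟨P, Q, hQ, h, -⟩ := (hreg q).along_curve p ha t₀ hpa
  exact ⟨P, Q, hQ, fun t => h _ (hγ t) _ (hpγ t)⟩

theorem coeff_apply_monomial_mem_rationalAt {L : Type*} [Field L] {n : ℕ} {t₀ : L}
    {γ : Lˣ → Aut0 L n} (hγ : ∀ q, (fun t => coord (γ t) q) ∈ rationalAt t₀)
    (m m' : Fin n →₀ ℕ) :
    (fun t => coeff m ((γ t).1 (monomial m' 1))) ∈ rationalAt t₀ := by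
  classical
  have add : ∀ a b : Fin n →₀ ℕ,
      (∀ m, (fun t => coeff m ((γ t).1 (monomial a 1))) ∈ rationalAt t₀) →
      (∀ m, (fun t => coeff m ((γ t).1 (monomial b 1))) ∈ rationalAt t₀) →
      ∀ m, (fun t => coeff m ((γ t).1 (monomial (a + b) 1))) ∈ rationalAt t₀ := by
    intro a b ha hb m
    have h : (fun t => coeff m ((γ t).1 (monomial (a + b) 1)))
        = ∑ x ∈ Finset.HasAntidiagonal.antidiagonal m, (fun t => coeff x.1 ((γ t).1 (monomial a 1)))
          * fun t => coeff x.2 ((γ t).1 (monomial b 1)) := by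
      funext t
      have hab : (monomial (a + b) 1 : MvPolynomial (Fin n) L) = monomial a 1 * monomial b 1 := by
        simp
      rw [hab, map_mul, coeff_mul, Finset.sum_apply]
      rfl
    rw [h]
    exact Subalgebra.sum_mem _ fun x _ => Subalgebra.mul_mem _ (ha _) (hb _)
  have zero : ∀ m, (fun t => coeff m ((γ t).1 (monomial 0 1))) ∈ rationalAt t₀ := by
    intro m
    have h : (fun t => coeff m ((γ t).1 (monomial 0 1)))
        = algebraMap L (Lˣ → L) (coeff m (1 : MvPolynomial (Fin n) L)) := by
      funext t
      rw [monomial_zero', C_1, map_one]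
      rfl
    rw [h]
    exact Subalgebra.algebraMap_mem _ _
  have one : ∀ (i : Fin n) m,
      (fun t => coeff m ((γ t).1 (monomial (Finsupp.single i 1) 1))) ∈ rationalAt t₀ :=
    fun i m => hγ (i, m)
  induction m' using Finsupp.induction_linear generalizing m with
  | zero => exact zero m
  | add a b ha hb => exact add a b ha hb m
  | single i k =>
    induction k generalizing m with
    | zero => rw [Finsupp.single_zero]; exact zero m
    | succ k ih => rw [Finsupp.single_add]; exact add _ _ ih (one i) m

/-! ### The image of the dilations -/

theorem coord_map_dilation_mem_rationalAt {K L : Type*} [Field K] [Field L] [Algebra K L] {n : ℕ}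
    {φ : Aut0 L n ≃* Aut0 L n} (hφ : IsIndAut K φ) (q : Fin n × (Fin n →₀ ℕ)) :
    (fun t => coord (φ (dilation L n t)) q) ∈ rationalAt (1 : L) := by
  refine hφ.1.coord_mem_rationalAt (d := 1)
    (fun q => Polynomial.X * Polynomial.C (coord (1 : Aut0 L n) q)) (a := 1) ?_ (fun q => ?_)
    dilation_mem_degreeLE (fun t q => ?_) q
  · rw [← map_one (dilation L n)]
    exact dilation_mem_degreeLE 1
  · simp
  · rw [coord_dilation, Polynomial.eval_mul, Polynomial.eval_X, Polynomial.eval_C]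

/-- Conjugation by the dilations contracts every automorphism `f` to its linear part. Therefore the
image of the conjugate of `f` has a limit at `t = 0`. -/
theorem coord_map_dilation_conj_mem_rationalAt {K L : Type*} [Field K] [Field L] [Algebra K L]
    {n : ℕ} {φ : Aut0 L n ≃* Aut0 L n} (hφ : IsIndAut K φ) (f : Aut0 L n)
    (q : Fin n × (Fin n →₀ ℕ)) :
    (fun t => coord (φ (dilation L n t * f * (dilation L n t)⁻¹)) q) ∈ rationalAt (0 : L) := by
  obtain ⟨d, hd, hf⟩ := exists_mem_degreeLE f
  refine hφ.1.coord_mem_rationalAt (d := d)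
    (fun q => Polynomial.X ^ (q.2.degree - 1) * Polynomial.C (coord f q))
    (a := linearAut L n (Units.map (linearPart L n) (toUnits f)))
    (linearAut_mem_degreeLE hd _) ?_ (fun t => dilation_conj_mem_degreeLE t hf) ?_ q
  · rintro ⟨i, m⟩
    rcases eq_or_ne m.degree 1 with h1 | h1
    · obtain ⟨j, rfl⟩ := exists_eq_single_of_degree_eq_one h1
      rw [coord_linearAut_single]
      simp [linearPart_apply]
    · rw [coord_linearAut_of_degree_ne_one _ _ h1]
      rcases Nat.eq_zero_or_pos m.degree with h0 | h0
      · simp [coord_eq_zero_of_degree_eq_zero f i h0]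
      · have : m.degree - 1 ≠ 0 := by omega
        simp [this]
  · rintro t ⟨i, m⟩
    rw [coord_dilation_conj, Polynomial.eval_mul, Polynomial.eval_pow, Polynomial.eval_X,
      Polynomial.eval_C]

/-- A nonzero matrix `W` with `W * M ∈ (matrices) * W` for all invertible `M` is injective: its
kernel is invariant under all transvections. -/
theorem mulVec_injective_of_forall_unit {L : Type*} [Field L] {n : ℕ}
    {W : Matrix (Fin n) (Fin n) L} (hW : W ≠ 0)
    (h : ∀ M : (Matrix (Fin n) (Fin n) L)ˣ, ∃ T, W * M.1 = T * W) :
    Function.Injective W.mulVec := by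
  have htrans : ∀ i j, i ≠ j → ∀ v, W.mulVec v = 0 →
      W.mulVec ((Matrix.single i j (1 : L)).mulVec v) = 0 := by
    intro i j hij v hv
    let M : (Matrix (Fin n) (Fin n) L)ˣ := ⟨Matrix.transvection i j 1, Matrix.transvection i j (-1),
      by rw [Matrix.transvection_mul_transvection_same i j hij]; simp,
      by rw [Matrix.transvection_mul_transvection_same i j hij]; simp⟩
    obtain ⟨T, hT⟩ := h M
    have h1 := congrArg (fun A => A.mulVec v) hT
    simp only [M, ← Matrix.mulVec_mulVec, hv, Matrix.mulVec_zero] at h1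
    rw [Matrix.transvection, Matrix.add_mulVec, Matrix.one_mulVec, Matrix.mulVec_add, hv,
      zero_add] at h1
    exact h1
  have hsingle : ∀ (i j : Fin n) (v : Fin n → L),
      (Matrix.single i j (1 : L)).mulVec v = v j • Pi.single i (1 : L) := by
    intro i j v
    ext x
    simp [Matrix.single_mulVec, Function.update_apply, Pi.single_apply]
  refine (injective_iff_map_eq_zero (Matrix.mulVecLin W)).2 fun v hv => ?_
  by_contra hne
  obtain ⟨j, hj⟩ := Function.ne_iff.1 hne
  rw [Pi.zero_apply] at hj
  rw [Matrix.mulVecLin_apply] at hv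
  have hi : ∀ i, i ≠ j → W.mulVec (Pi.single i 1) = 0 := by
    intro i hij
    have h1 := htrans i j hij v hv
    rw [hsingle, Matrix.mulVec_smul] at h1
    exact (smul_eq_zero.1 h1).resolve_left hj
  have hall : ∀ i, W.mulVec (Pi.single i 1) = 0 := by
    intro i
    rcases ne_or_eq i j with hij | rfl
    · exact hi i hij
    by_cases hex : ∃ k, k ≠ i
    · obtain ⟨k, hk⟩ := hex
      have h1 := htrans i k hk.symm _ (hi k hk)
      rw [hsingle] at h1
      simpa using h1
    · push Not at hex
      have hv' : v = v i • Pi.single i 1 := by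
        ext x
        rw [hex x]
        simp
      rw [hv', Matrix.mulVec_smul] at hv
      exact (smul_eq_zero.1 hv).resolve_left hj
  refine hW (Matrix.ext fun x i => ?_)
  have h1 := congrFun (hall i) x
  simpa using h1

/-- The lowest weight part of a rational representation `R` intertwines `M` with the limit at
`t = 0` of its conjugates by the `R t`, if that limit exists. -/
theorem exists_lowest_weight_mul_eq {L ι : Type*} [Field L] [Infinite L] [Fintype ι]
    {R : Lˣ → Matrix ι ι L} {s : Finset ℤ} {W : ℤ → Matrix ι ι L}
    (hR : ∀ t : Lˣ, R t = ∑ l ∈ s, ((t ^ l : Lˣ) : L) • W l) {l₀ : ℤ} (hl₀ : l₀ ∈ s)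
    (hmin : ∀ l ∈ s, l₀ ≤ l) (M : Matrix ι ι L) {T : Lˣ → Matrix ι ι L}
    (hT : ∀ i j, (fun t => T t i j) ∈ rationalAt (0 : L)) (hTR : ∀ t, T t * R t = R t * M) :
    ∃ T₀, W l₀ * M = T₀ * W l₀ := by
  obtain ⟨P, Q, hQ, hPQ⟩ := exists_common_denominator (t₀ := (0 : L))
    (u := fun (x : ι × ι) t => T t x.1 x.2) fun x => hT x.1 x.2
  let V : ι → ι → Polynomial L := fun i j =>
    ∑ l ∈ s, Polynomial.X ^ (l - l₀).toNat * Polynomial.C (W l i j)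
  have hV0 : ∀ i j, (V i j).eval 0 = W l₀ i j := by
    intro i j
    simp only [V, Polynomial.eval_finsetSum]
    rw [Finset.sum_eq_single_of_mem l₀ hl₀]
    · simp
    · intro l hl hne
      have h1 := hmin l hl
      have : (l - l₀).toNat ≠ 0 := by omega
      simp [this]
  have hV : ∀ (t : Lˣ) i j, R t i j = ((t ^ l₀ : Lˣ) : L) * (V i j).eval ↑t := by
    intro t i j
    simp only [V, Polynomial.eval_finsetSum, hR, Matrix.sum_apply, Finset.mul_sum]
    refine Finset.sum_congr rfl fun l hl => ?_
    have h1 : t ^ l = t ^ l₀ * t ^ (l - l₀).toNat := by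
      rw [← zpow_natCast, ← zpow_add, Int.toNat_of_nonneg (sub_nonneg.2 (hmin l hl))]
      congr 1
      ring
    rw [h1]
    simp [mul_assoc, mul_comm (W l i j)]
  have key : ∀ i j, Q * ∑ k, V i k * Polynomial.C (M k j) = ∑ k, P (i, k) * V k j := by
    intro i j
    refine polynomial_eq_of_eval_units fun t => ?_
    have h1 := congrFun (congrFun (hTR t) i) j
    simp only [Matrix.mul_apply, hV] at h1
    refine mul_left_cancel₀ (t ^ l₀ : Lˣ).ne_zero ?_
    simp only [Polynomial.eval_mul, Polynomial.eval_finsetSum, Polynomial.eval_C, ← hPQ]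
    calc ((t ^ l₀ : Lˣ) : L) * (Q.eval ↑t * ∑ k, (V i k).eval ↑t * M k j)
        = Q.eval ↑t * ∑ k, ((t ^ l₀ : Lˣ) : L) * (V i k).eval ↑t * M k j := by
          rw [mul_left_comm, Finset.mul_sum]
          simp only [mul_assoc]
      _ = _ := by
          rw [← h1, Finset.mul_sum, Finset.mul_sum]
          refine Finset.sum_congr rfl fun k _ => ?_
          ring
  refine ⟨Matrix.of fun i k => (Q.eval 0)⁻¹ * (P (i, k)).eval 0, Matrix.ext fun i j => ?_⟩
  have h1 := congrArg (Polynomial.eval 0) (key i j)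
  simp only [Polynomial.eval_mul, Polynomial.eval_finsetSum, Polynomial.eval_C, hV0] at h1
  simp only [Matrix.mul_apply, Matrix.of_apply, mul_assoc]
  rw [← Finset.mul_sum, ← h1, inv_mul_cancel_left₀ hQ]

/-- The linear parts of the images of the dilations are scalar matrices `t ^ a`. Indeed, every
automorphism is of the form `φ f`, and its conjugates by the `φ (dilation t)` have a limit at
`t = 0`. -/
theorem exists_linearPart_map_dilation {K L : Type*} [Field K] [Field L] [Algebra K L]
    [Infinite L] {n : ℕ} {φ : Aut0 L n ≃* Aut0 L n} (hφ : IsIndAut K φ) :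
    ∃ a : ℤ, ∀ t : Lˣ, linearPart L n (φ (dilation L n t)) = ((t ^ a : Lˣ) : L) • 1 := by
  rcases Nat.eq_zero_or_pos n with rfl | hn
  · exact ⟨0, fun t => Subsingleton.elim _ _⟩
  have : NeZero n := ⟨hn.ne'⟩
  let R : Lˣ →* Matrix (Fin n) (Fin n) L :=
    (linearPart L n).comp (φ.toMonoidHom.comp (dilation L n))
  obtain ⟨s, W, hW0, hR, hWR⟩ := exists_weight_decomposition R fun i j =>
    coord_map_dilation_mem_rationalAt hφ (j, Finsupp.single i 1)
  have hs : s.Nonempty := by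
    rw [Finset.nonempty_iff_ne_empty]
    rintro rfl
    have := hR 1
    rw [map_one, Finset.sum_empty] at this
    exact one_ne_zero this
  have hmem := s.min'_mem hs
  have hinj := mulVec_injective_of_forall_unit (hW0 _ hmem) fun M => by
    refine exists_lowest_weight_mul_eq hR hmem (fun l hl => s.min'_le l hl) M.1
      (T := fun t => linearPart L n (φ (dilation L n t * φ.symm (linearAut L n M)
        * (dilation L n t)⁻¹))) (fun i j => ?_) fun t => ?_
    · exact coord_map_dilation_conj_mem_rationalAt hφ _ (j, Finsupp.single i 1)
    · rw [← linearPart_linearAut M]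
      change _ * linearPart L n (φ (dilation L n t))
        = linearPart L n (φ (dilation L n t)) * _
      rw [← map_mul, ← map_mul, ← map_mul, inv_mul_cancel_right, map_mul φ, φ.apply_symm_apply]
  refine ⟨s.min' hs, fun t => Matrix.ext_of_mulVec_single fun i => hinj ?_⟩
  have h1 := hWR _ hmem t
  change W _ * linearPart L n (φ (dilation L n t)) = _ at h1
  rw [Matrix.mulVec_mulVec, Matrix.mulVec_mulVec, h1, Matrix.mul_smul, Matrix.mul_one]

/-- If the linear parts of the images of the dilations are `t ^ a`, then these images act on jets
with the weights `a * j`, `1 ≤ j ≤ k`. -/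
theorem exists_jet_map_dilation_eq_sum {K L : Type*} [Field K] [Field L] [Algebra K L]
    [Infinite L] {n : ℕ} {φ : Aut0 L n ≃* Aut0 L n} (hφ : IsIndAut K φ) {a : ℤ}
    (ha : ∀ t : Lˣ, linearPart L n (φ (dilation L n t)) = ((t ^ a : Lˣ) : L) • 1) (k : ℕ) :
    ∃ W : ℕ → Matrix (jetExponents n k) (jetExponents n k) L, ∀ t : Lˣ,
      jet L n k (φ (dilation L n t)) = ∑ j ∈ Finset.Icc 1 k, ((t ^ a : Lˣ) : L) ^ j • W j := by
  classical
  let R : Lˣ →* Matrix (jetExponents n k) (jetExponents n k) L :=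
    (jet L n k).comp (φ.toMonoidHom.comp (dilation L n))
  obtain ⟨s, W, hW0, hR, hWR⟩ := exists_weight_decomposition R fun i j =>
    coeff_apply_monomial_mem_rationalAt (coord_map_dilation_mem_rationalAt hφ) i.1 j.1
  have hweight : ∀ l ∈ s, ∃ j ∈ Finset.Icc 1 k, l = a * j := by
    intro l hl
    obtain ⟨m₀, hm₀⟩ : ∃ m₀, W l m₀ ≠ 0 := by
      by_contra! h
      exact hW0 l hl (funext h)
    obtain ⟨m₁, hm₁⟩ := Function.ne_iff.1 hm₀
    -- The last nonzero entry of a row of `W l` is multiplied by a diagonal entry of `R t`.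
    obtain ⟨m, hm, hmax⟩ := Finset.exists_max_image
      (Finset.univ.filter fun m => W l m₀ m ≠ 0) (fun m => m.1.degree) ⟨m₁, by simpa using hm₁⟩
    rw [Finset.mem_filter] at hm
    have hmk := mem_jetExponents.1 m.2
    refine ⟨m.1.degree, Finset.mem_Icc.2 hmk, zpow_unit_injective (L := L) fun t => ?_⟩
    have h1 := congrFun (congrFun (hWR l hl t) m₀) m
    rw [Matrix.mul_apply, Finset.sum_eq_single m] at h1
    · have h2 : R t m m = ((t ^ a : Lˣ) : L) ^ m.1.degree := by
        refine (coeff_apply_monomial_of_linearPart (ha t) rfl).trans ?_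
        rw [if_pos rfl]
      rw [h2, Matrix.smul_apply, smul_eq_mul, mul_comm] at h1
      have h3 := mul_right_cancel₀ hm.2 h1
      refine Units.ext ?_
      rw [← h3, zpow_mul, zpow_natCast, Units.val_pow_eq_pow_val]
    · intro m' _ hne
      rcases lt_trichotomy m'.1.degree m.1.degree with hlt | heq | hgt
      · have h2 : R t m' m = 0 := coeff_apply_monomial_of_degree_lt _ hlt
        rw [h2, mul_zero]
      · have h2 : R t m' m = 0 := by
          refine (coeff_apply_monomial_of_linearPart (ha t) heq).trans ?_
          rw [if_neg fun h => hne (Subtype.ext h)]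
        rw [h2, mul_zero]
      · have h2 : W l m₀ m' = 0 := by
          by_contra h
          exact absurd (hmax m' (by simpa using h)) (not_le.2 hgt)
        rw [h2, zero_mul]
    · exact fun h => absurd (Finset.mem_univ m) h
  choose! j hj hja using hweight
  -- For `a = 0` several `j` belong to the same weight, hence the choice of one of them.
  refine ⟨fun i => ∑ l ∈ s with j l = i, W l, fun t => (hR t).trans ?_⟩
  rw [← Finset.sum_fiberwise_of_maps_to hj]
  refine Finset.sum_congr rfl fun i _ => ?_
  rw [Finset.smul_sum]
  refine Finset.sum_congr rfl fun l hl => ?_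
  rw [Finset.mem_filter] at hl
  rw [← Units.val_pow_eq_pow_val, ← zpow_natCast, ← zpow_mul, ← hl.2, ← hja l hl.1]

/-- The parameter `t` is a rational function of `t ^ a` only for `a = 1` and `a = -1`. -/
theorem eq_one_or_eq_neg_one_of_rational {L : Type*} [Field L] [Infinite L] {a : ℤ}
    {P Q : Polynomial L} (hQ : Q.eval 1 ≠ 0)
    (h : ∀ t : Lˣ, t * Q.eval ((t ^ a : Lˣ) : L) = P.eval ((t ^ a : Lˣ) : L)) :
    a = 1 ∨ a = -1 := by
  have hndvd : ∀ b c : ℕ, 2 ≤ b → b ∣ c → ¬ b ∣ c + 1 := fun b c hb hc hc' => by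
    have := (Nat.dvd_add_right hc).1 hc'
    have := Nat.le_of_dvd one_pos this
    omega
  obtain ⟨b, rfl | rfl⟩ := a.eq_nat_or_neg
  · left
    have h1 : Polynomial.X * Polynomial.expand L b Q = Polynomial.expand L b P := by
      refine polynomial_eq_of_eval_units fun t => ?_
      rw [Polynomial.eval_mul, Polynomial.eval_X, Polynomial.expand_eval, Polynomial.expand_eval]
      simpa using h t
    rcases lt_trichotomy b 1 with hb | rfl | hb
    · obtain rfl : b = 0 := by omega
      have h2 := congrArg (fun p => Polynomial.coeff p 1) h1
      simp [Polynomial.expand_zero, hQ, Polynomial.coeff_C] at h2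
    · rfl
    · refine absurd (?_ : Q = 0) (by rintro rfl; simp at hQ)
      ext i
      have h2 := congrArg (fun p => Polynomial.coeff p (i * b + 1)) h1
      simp only [Polynomial.coeff_X_mul] at h2
      rw [Polynomial.coeff_expand_mul (by omega), Polynomial.coeff_expand (by omega),
        if_neg (hndvd b _ hb (dvd_mul_left _ _))] at h2
      rw [h2, Polynomial.coeff_zero]
  · right
    have h1 : Polynomial.expand L b Q = Polynomial.X * Polynomial.expand L b P := by
      refine polynomial_eq_of_eval_units fun t => ?_
      rw [Polynomial.eval_mul, Polynomial.eval_X, Polynomial.expand_eval, Polynomial.expand_eval]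
      have h2 := h t⁻¹
      rw [inv_zpow, zpow_neg, inv_inv, zpow_natCast, Units.val_pow_eq_pow_val] at h2
      rw [← h2, Units.mul_inv_cancel_left]
    rcases lt_trichotomy b 1 with hb | rfl | hb
    · obtain rfl : b = 0 := by omega
      have h2 := congrArg (fun p => Polynomial.coeff p 0) h1
      simp [Polynomial.expand_zero, hQ] at h2
    · rfl
    · refine absurd (?_ : Q = 0) (by rintro rfl; simp at hQ)
      ext i
      have h2 := congrArg (fun p => Polynomial.coeff p (i * b)) h1
      simp only [Polynomial.coeff_expand_mul (show 0 < b by omega)] at h2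
      rw [h2, Polynomial.coeff_zero]
      rcases hc : i * b with _ | c
      · rw [Polynomial.coeff_X_mul_zero]
      · rw [Polynomial.coeff_X_mul, Polynomial.coeff_expand (by omega), if_neg]
        intro hbc
        exact hndvd b c hb hbc (hc ▸ dvd_mul_left b i)

/-! ### Preservation of the augmentation subgroups -/

/-- The images of the dilations have linear part `t ^ a` with `a = 1` or `a = -1`: their coordinates
are polynomials in `t ^ a`, and they determine `t` since the inverse of `φ` is regular. -/
theorem exists_linearPart_map_dilation_eq_one_or_neg_one {K L : Type*} [Field K] [Field L]
    [Algebra K L] [Infinite L] {n : ℕ} [NeZero n] {φ : Aut0 L n ≃* Aut0 L n} (hφ : IsIndAut K φ) :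
    ∃ a : ℤ, (a = 1 ∨ a = -1) ∧
      ∀ t : Lˣ, linearPart L n (φ (dilation L n t)) = ((t ^ a : Lˣ) : L) • 1 := by
  classical
  obtain ⟨a, ha⟩ := exists_linearPart_map_dilation hφ
  refine ⟨a, ?_, ha⟩
  obtain ⟨d, hd, -⟩ := hφ.1 1
  have hk : 1 ≤ max 1 d := le_max_left _ _
  have hE : ∀ t, φ (dilation L n t) ∈ degreeLE L n (max 1 d) := fun t =>
    degreeLE_mono (le_max_right _ _) (hd (dilation_mem_degreeLE t))
  generalize max 1 d = k at hk hE
  obtain ⟨W, hW⟩ := exists_jet_map_dilation_eq_sum hφ ha k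
  let p : Fin n × (Fin n →₀ ℕ) → Polynomial L := fun q =>
    if h : q.2 ∈ jetExponents n k then
      ∑ j ∈ Finset.Icc 1 k, Polynomial.X ^ j * Polynomial.C
        (W j ⟨q.2, h⟩ ⟨Finsupp.single q.1 1, single_mem_jetExponents hk q.1⟩)
    else 0
  have hp : ∀ t q, coord (φ (dilation L n t)) q = (p q).eval ((t ^ a : Lˣ) : L) := by
    rintro t ⟨i, m⟩
    by_cases h : m ∈ jetExponents n k
    · simp only [p, dif_pos h, Polynomial.eval_finsetSum, Polynomial.eval_mul, Polynomial.eval_pow,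
        Polynomial.eval_X, Polynomial.eval_C]
      rw [← jet_apply_single hk (φ (dilation L n t)) ⟨m, h⟩ i, hW, Matrix.sum_apply]
      rfl
    · simp only [p, dif_neg h, Polynomial.eval_zero]
      rw [mem_jetExponents, not_and_or, not_le, not_le, Nat.lt_one_iff] at h
      rcases h with h | h
      · exact coord_eq_zero_of_degree_eq_zero _ i h
      · exact mem_degreeLE_iff.1 (hE t) i m h
  obtain ⟨_, -, hreg⟩ := hφ.2 k
  obtain ⟨P, Q, hQ, hPQ, -⟩ := (hreg (0, Finsupp.single 0 1)).along_curve p (hE 1) 1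
    fun q => by simpa using hp 1 q
  refine eq_one_or_eq_neg_one_of_rational (P := P) hQ fun t => ?_
  rw [← hPQ _ (hE t) _ (hp t)]
  rw [φ.symm_apply_apply, coord_dilation]
  have h1 : coord (1 : Aut0 L n) (0, Finsupp.single 0 1) = 1 := by
    simpa [linearPart_apply] using congrFun (congrFun (map_one (linearPart L n)) 0) 0
  rw [h1, mul_one]

/-- A Laurent polynomial with exponents less than `k` in absolute value that is divisible by `t ^ k`
in the local ring at `0` vanishes. -/
theorem laurent_eq_zero_of_dvd {L ι : Type*} [Field L] [Infinite L] {k : ℕ} {s : Finset ι}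
    {c : ι → L} {e : ι → ℤ} (he : ∀ x ∈ s, |e x| < k) {P Q : Polynomial L} (hQ : Q.eval 0 ≠ 0)
    (h : ∀ t : Lˣ, (∑ x ∈ s, ((t ^ e x : Lˣ) : L) * c x) * Q.eval ↑t = (t : L) ^ k * P.eval ↑t)
    (t : Lˣ) : ∑ x ∈ s, ((t ^ e x : Lˣ) : L) * c x = 0 := by
  let U : Polynomial L := ∑ x ∈ s, Polynomial.X ^ (e x + k).toNat * Polynomial.C (c x)
  have hU : ∀ t : Lˣ, U.eval ↑t = (t : L) ^ k * ∑ x ∈ s, ((t ^ e x : Lˣ) : L) * c x := by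
    intro t
    simp only [U, Polynomial.eval_finsetSum, Polynomial.eval_mul, Polynomial.eval_pow,
      Polynomial.eval_X, Polynomial.eval_C, Finset.mul_sum, ← mul_assoc]
    refine Finset.sum_congr rfl fun x hx => ?_
    have h1 := (abs_lt.1 (he x hx)).1
    rw [← Units.val_pow_eq_pow_val, ← Units.val_pow_eq_pow_val, ← Units.val_mul,
      ← zpow_natCast, ← zpow_natCast, Int.toNat_of_nonneg (by omega), ← zpow_add, add_comm]
  have hdeg : U.degree < (2 * k : ℕ) := by
    refine (Polynomial.degree_sum_le _ _).trans_lt ((Finset.sup_lt_iff (WithBot.bot_lt_coe _)).2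
      fun x hx => ?_)
    rw [mul_comm]
    refine (Polynomial.degree_C_mul_X_pow_le _ _).trans_lt ?_
    have h1 := abs_lt.1 (he x hx)
    exact_mod_cast (show (e x + k).toNat < 2 * k by omega)
  have hmul : U * Q = Polynomial.X ^ (2 * k) * P := by
    refine polynomial_eq_of_eval_units fun t => ?_
    rw [Polynomial.eval_mul, hU, mul_assoc, h, Polynomial.eval_mul, Polynomial.eval_pow,
      Polynomial.eval_X, ← mul_assoc, ← pow_add, two_mul]
  have hdvd : Polynomial.X ^ (2 * k) ∣ U := by
    refine Polynomial.prime_X.pow_dvd_of_dvd_mul_right (2 * k) (fun hX => hQ ?_) ⟨P, hmul⟩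
    rw [← Polynomial.coeff_zero_eq_eval_zero]
    exact Polynomial.X_dvd_iff.1 hX
  have hU0 : U = 0 := Polynomial.eq_zero_of_dvd_of_degree_lt hdvd (by
    rw [Polynomial.degree_X_pow]
    exact hdeg)
  have h1 := hU t
  rw [hU0, Polynomial.eval_zero] at h1
  exact (mul_eq_zero.1 h1.symm).resolve_left (pow_ne_zero _ t.ne_zero)

/-- If `f` is the identity up to degree `k`, then its conjugates by dilations are congruent to the
identity modulo `t ^ k`, and `φ` preserves this congruence. -/
theorem exists_coord_map_dilation_conj_sub_eq {K L : Type*} [Field K] [Field L] [Algebra K L]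
    {n : ℕ} {φ : Aut0 L n ≃* Aut0 L n} (hφ : IsIndAut K φ) {k : ℕ} (hk : 1 ≤ k) {f : Aut0 L n}
    (hf : f ∈ augSubgroup L n (k + 1)) (q : Fin n × (Fin n →₀ ℕ)) :
    ∃ P Q : Polynomial L, Q.eval 0 ≠ 0 ∧ ∀ t : Lˣ,
      (coord (φ (dilation L n t * f * (dilation L n t)⁻¹)) q - coord (1 : Aut0 L n) q) * Q.eval ↑t
        = (t : L) ^ k * P.eval ↑t := by
  obtain ⟨d, hd, hfd⟩ := exists_mem_degreeLE f
  rw [mem_augSubgroup_iff] at hf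
  have hone : ∀ i (m : Fin n →₀ ℕ), m.degree ≠ 1 → coord (1 : Aut0 L n) (i, m) = 0 := by
    intro i m hm
    rw [← map_one (linearAut L n)]
    exact coord_linearAut_of_degree_ne_one _ i hm
  have h1d : (1 : Aut0 L n) ∈ degreeLE L n d := by
    rw [← map_one (linearAut L n)]
    exact linearAut_mem_degreeLE hd _
  let p : Fin n × (Fin n →₀ ℕ) → Polynomial L := fun q =>
    Polynomial.X ^ (q.2.degree - 1) * Polynomial.C (coord f q)
  have hp : ∀ q, p q - Polynomial.C (coord (1 : Aut0 L n) q)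
      ∈ Ideal.span {(Polynomial.X : Polynomial L) ^ k} := by
    rintro ⟨i, m⟩
    rcases Nat.lt_or_ge m.degree (k + 1) with hm | hm
    · rcases eq_or_ne m.degree 1 with h1 | h1
      · simp [p, h1, hf i m hm]
      · simp [p, hf i m hm, hone i m h1]
    · rw [hone i m (by omega), Polynomial.C_0, sub_zero]
      exact Ideal.mul_mem_right _ _ (Ideal.mem_span_singleton.2
        (pow_dvd_pow _ (Nat.le_sub_one_of_lt hm)))
  have hp0 : ∀ q, coord (1 : Aut0 L n) q = (p q).eval 0 := by
    intro q
    obtain ⟨c, hc⟩ := Ideal.mem_span_singleton.1 (hp q)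
    have h1 := congrArg (Polynomial.eval 0) hc
    have hk0 : k ≠ 0 := by omega
    simp only [Polynomial.eval_sub, Polynomial.eval_C, Polynomial.eval_mul, Polynomial.eval_pow,
      Polynomial.eval_X, zero_pow hk0, zero_mul] at h1
    exact (sub_eq_zero.1 h1).symm
  obtain ⟨_, -, hreg⟩ := hφ.1 d
  obtain ⟨P, Q, hQ, hPQ, hI⟩ := (hreg q).along_curve p h1d 0 hp0
  obtain ⟨P', hP'⟩ := Ideal.mem_span_singleton.1 (hI _ hp)
  refine ⟨P', Q, hQ, fun t => ?_⟩
  have h1 := hPQ _ (dilation_conj_mem_degreeLE t hfd) t (by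
    rintro ⟨i, m⟩
    simp only [p, coord_dilation_conj, Polynomial.eval_mul, Polynomial.eval_pow, Polynomial.eval_X,
      Polynomial.eval_C])
  have h2 := congrArg (Polynomial.eval (t : L)) hP'
  simp only [Polynomial.eval_sub, Polynomial.eval_mul, Polynomial.eval_C, Polynomial.eval_pow,
    Polynomial.eval_X, map_one] at h2
  rw [sub_mul, h1, h2]

theorem map_mem_augSubgroup {K L : Type*} [Field K] [Field L] [Algebra K L] [Infinite L] {n : ℕ}
    {φ : Aut0 L n ≃* Aut0 L n} (hφ : IsIndAut K φ) {N : ℕ} (hN : 1 < N) {f : Aut0 L n}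
    (hf : f ∈ augSubgroup L n N) : φ f ∈ augSubgroup L n N := by
  classical
  rcases Nat.eq_zero_or_pos n with rfl | hn
  · exact fun i => i.elim0
  have : NeZero n := ⟨hn.ne'⟩
  obtain ⟨k, rfl⟩ := Nat.exists_eq_add_of_le' hN.le
  have hk : 1 ≤ k := by omega
  obtain ⟨a, ha1, ha⟩ := exists_linearPart_map_dilation_eq_one_or_neg_one hφ
  obtain ⟨W, hW⟩ := exists_jet_map_dilation_eq_sum hφ ha k
  rw [mem_augSubgroup_iff]
  intro i m hm
  rcases Nat.eq_zero_or_pos m.degree with h0 | h0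
  · rw [coord_eq_zero_of_degree_eq_zero _ i h0, coord_eq_zero_of_degree_eq_zero _ i h0]
  have hmk : m ∈ jetExponents n k := mem_jetExponents.2 ⟨h0, by omega⟩
  obtain ⟨P, Q, hQ, hPQ⟩ := exists_coord_map_dilation_conj_sub_eq hφ hk hf (i, m)
  let r : jetExponents n k := ⟨m, hmk⟩
  let r' : jetExponents n k := ⟨Finsupp.single i 1, single_mem_jetExponents hk i⟩
  let M := jet L n k (φ f) - 1
  -- The weights lie between `1` and `k`, so their differences are less than `k`.
  have hconj : ∀ t : Lˣ, coord (φ (dilation L n t * f * (dilation L n t)⁻¹)) (i, m)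
      - coord (1 : Aut0 L n) (i, m) = ∑ x ∈ Finset.Icc 1 k ×ˢ Finset.Icc 1 k,
        ((t ^ (a * (x.1 - x.2)) : Lˣ) : L) * (W x.1 * M * W x.2) r r' := by
    intro t
    have h1 : jet L n k (φ (dilation L n t * f * (dilation L n t)⁻¹)) - 1
        = jet L n k (φ (dilation L n t)) * M * jet L n k (φ (dilation L n t⁻¹)) := by
      rw [mul_sub, sub_mul, mul_one, ← map_mul, ← map_mul, ← map_mul, ← map_mul, ← map_mul,
        ← map_mul, ← map_mul, mul_inv_cancel, map_one, map_one, map_one, map_inv]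
    have h2 := congrFun (congrFun h1 r) r'
    rw [Matrix.sub_apply, ← map_one (jet L n k)] at h2
    refine h2.trans ?_
    rw [hW, hW, Finset.sum_mul, Finset.sum_mul_sum, ← Finset.sum_product', Matrix.sum_apply]
    refine Finset.sum_congr rfl fun x _ => ?_
    rw [Matrix.smul_mul, Matrix.smul_mul, Matrix.mul_smul, smul_smul, Matrix.smul_apply,
      smul_eq_mul]
    congr 1
    rw [← Units.val_pow_eq_pow_val, ← Units.val_pow_eq_pow_val, ← Units.val_mul, inv_zpow,
      inv_pow, ← zpow_natCast, ← zpow_natCast, ← zpow_mul, ← zpow_mul, mul_sub, zpow_sub]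
  have h1 := laurent_eq_zero_of_dvd (L := L) (k := k) (s := Finset.Icc 1 k ×ˢ Finset.Icc 1 k)
    (c := fun x => (W x.1 * M * W x.2) r r') (e := fun x => a * (x.1 - x.2)) (fun x hx => by
      simp only [Finset.mem_product, Finset.mem_Icc] at hx
      rw [abs_lt]
      rcases ha1 with rfl | rfl <;> constructor <;> omega) hQ (fun t => by
      rw [← hconj]
      exact hPQ t) 1
  rw [← hconj, sub_eq_zero] at h1
  simpa using h1

/-! ### Descent to the base field -/

theorem coord_extendScalars {K : Type*} (L : Type*) [Field K] [Field L] [Algebra K L] {n : ℕ}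
    (f : Aut0 K n) (q : Fin n × (Fin n →₀ ℕ)) :
    coord (extendScalars L f) q = algebraMap K L (coord f q) := by
  have h : (extendScalars L f).1 (X q.1) = map (algebraMap K L) (f.1 (X q.1)) := by
    change extendHom L f.1.toAlgHom (X q.1) = _
    simp [extendHom]
  rw [coord, h, coeff_map]
  rfl

theorem extendScalars_one (K L : Type*) [Field K] [Field L] [Algebra K L] (n : ℕ) :
    extendScalars L (1 : Aut0 K n) = 1 := by
  refine aut0_ext fun i => ?_
  change extendHom L (AlgHom.id K _) (X i) = X i
  rw [extendHom_id]
  rfl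

theorem extendScalars_mul {K L : Type*} [Field K] [Field L] [Algebra K L] {n : ℕ}
    (f g : Aut0 K n) : extendScalars L (f * g) = extendScalars L f * extendScalars L g := by
  refine aut0_ext fun i => ?_
  exact (DFunLike.congr_fun (extendHom_comp (L := L) f.1.toAlgHom g.1.toAlgHom) (X i)).symm

/-- A regular function over `K` takes values in `K` at points with coordinates in `K`. -/
theorem coord_map_extendScalars_mem_range {K L : Type*} [Field K] [Field L] [Algebra K L] {n : ℕ}
    {φ : Aut0 L n → Aut0 L n} (hφ : IsIndMorphism K φ) (f : Aut0 K n)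
    (q : Fin n × (Fin n →₀ ℕ)) :
    coord (φ (extendScalars L f)) q ∈ (algebraMap K L).range := by
  obtain ⟨d, -, hd⟩ := exists_mem_degreeLE (extendScalars L f)
  obtain ⟨_, -, hreg⟩ := hφ d
  obtain ⟨P, Q, hQ, h⟩ := hreg q _ hd
  have hK : ∀ G : MvPolynomial (Fin n × (Fin n →₀ ℕ)) K,
      aeval (coord (extendScalars L f)) G = algebraMap K L (aeval (coord f) G) := by
    intro G
    rw [← aeval_algebraMap_apply]
    congr 2
    funext q
    exact coord_extendScalars L f q
  refine ⟨aeval (coord f) P / aeval (coord f) Q, ?_⟩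
  rw [map_div₀, ← hK, ← hK]
  exact (h _ hd hQ).symm

/-- An automorphism over `L` is defined over `K` if its coefficients and those of its inverse lie
in `K`. -/
theorem exists_eq_extendScalars {K L : Type*} [Field K] [Field L] [Algebra K L] {n : ℕ}
    {F F' : Aut0 L n} (hFF' : F * F' = 1) (hF'F : F' * F = 1)
    (hF : ∀ q, coord F q ∈ (algebraMap K L).range)
    (hF' : ∀ q, coord F' q ∈ (algebraMap K L).range) : ∃ g : Aut0 K n, F = extendScalars L g := by
  have hlift : ∀ G : Aut0 L n, (∀ q, coord G q ∈ (algebraMap K L).range) →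
      ∃ g : MvPolynomial (Fin n) K →ₐ[K] MvPolynomial (Fin n) K,
        extendHom L g = G.1.toAlgHom := by
    intro G hG
    have h1 : ∀ i, ∃ p : MvPolynomial (Fin n) K, map (algebraMap K L) p = G.1 (X i) := by
      intro i
      refine mem_range_map_iff_coeffs_subset.2 fun c hc => ?_
      obtain ⟨m, -, rfl⟩ := mem_coeffs_iff.1 hc
      exact hG (i, m)
    choose p hp using h1
    refine ⟨aeval p, MvPolynomial.algHom_ext fun i => ?_⟩
    simp [extendHom, hp]
  have hinj : ∀ g h : MvPolynomial (Fin n) K →ₐ[K] MvPolynomial (Fin n) K,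
      extendHom L g = extendHom L h → g = h := by
    intro g h hgh
    refine MvPolynomial.algHom_ext fun i => map_injective _ (algebraMap K L).injective ?_
    simpa [extendHom] using DFunLike.congr_fun hgh (X i)
  obtain ⟨g, hg⟩ := hlift F hF
  obtain ⟨g', hg'⟩ := hlift F' hF'
  have hgg' : g.comp g' = AlgHom.id K _ := by
    refine hinj _ _ ?_
    rw [← extendHom_comp, hg, hg', extendHom_id]
    exact congrArg (fun G : Aut0 L n => G.1.toAlgHom) hFF'
  have hg'g : g'.comp g = AlgHom.id K _ := by
    refine hinj _ _ ?_
    rw [← extendHom_comp, hg, hg', extendHom_id]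
    exact congrArg (fun G : Aut0 L n => G.1.toAlgHom) hF'F
  refine ⟨⟨AlgEquiv.ofAlgHom g g' hgg' hg'g, ?_⟩, aut0_ext fun i =>
    (DFunLike.congr_fun hg (X i)).symm⟩
  have h : augIdeal K n ≤ (augIdeal K n).comap g := by
    refine Ideal.span_le.2 ?_
    rintro _ ⟨i, rfl⟩
    rw [SetLike.mem_coe, Ideal.mem_comap, mem_augIdeal_iff]
    refine (algebraMap K L).injective ?_
    have h1 : map (algebraMap K L) (g (X i)) = F.1 (X i) := by
      simpa [extendHom] using DFunLike.congr_fun hg (X i)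
    rw [← constantCoeff_map, h1, constantCoeff_apply F.1 F.2, constantCoeff_X, map_zero]
  exact fun p hp => h hp

theorem extendScalars_mem_augSubgroup_iff {K L : Type*} [Field K] [Field L] [Algebra K L]
    {n N : ℕ} {f : Aut0 K n} :
    extendScalars L f ∈ augSubgroup L n N ↔ f ∈ augSubgroup K n N := by
  rw [mem_augSubgroup_iff, mem_augSubgroup_iff, ← extendScalars_one K L n]
  simp only [coord_extendScalars, (algebraMap K L).injective.eq_iff]

end PolyAut

end

theorem mainTheorem9 {K L : Type*} [Field K] [Field L] [Algebra K L] [Infinite L] {n : ℕ}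
    (φ : PolyAut.Aut0 L n ≃* PolyAut.Aut0 L n) (hφ : PolyAut.IsIndAut K φ)
    {N : ℕ} (hN : 1 < N) :
    (∀ f ∈ PolyAut.augSubgroup L n N, φ f ∈ PolyAut.augSubgroup L n N) ∧
    (∀ f ∈ PolyAut.augSubgroup K n N, ∃ g ∈ PolyAut.augSubgroup K n N,
      φ (PolyAut.extendScalars L f) = PolyAut.extendScalars L g) := by
  refine ⟨fun f hf => PolyAut.map_mem_augSubgroup hφ hN hf, fun f hf => ?_⟩
  obtain ⟨g, hg⟩ := PolyAut.exists_eq_extendScalars (K := K)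
    (F := φ (PolyAut.extendScalars L f)) (F' := φ (PolyAut.extendScalars L f⁻¹))
    (by rw [← map_mul, ← PolyAut.extendScalars_mul, mul_inv_cancel, PolyAut.extendScalars_one,
      map_one])
    (by rw [← map_mul, ← PolyAut.extendScalars_mul, inv_mul_cancel, PolyAut.extendScalars_one,
      map_one])
    (PolyAut.coord_map_extendScalars_mem_range hφ.1 f)
    (PolyAut.coord_map_extendScalars_mem_range hφ.1 f⁻¹)
  refine ⟨g, (PolyAut.extendScalars_mem_augSubgroup_iff (L := L)).1 ?_, hg⟩
  rw [← hg]
  exact PolyAut.map_mem_augSubgroup hφ hN (PolyAut.extendScalars_mem_augSubgroup_iff.2 hf)
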